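/- **Theorem (Filter algorithm for linear regression).** *Setting.* Let $(X_i,Y_i)\in\mathbb R^d\times\mathbb R$, $i\in[n]$, $n\ge 1$, and let $S\subseteq[n]$ with $|S|=(1-\epsilon)n$; $p_S$ is the uniform distribution on $S$. For a distribution $q$ on $[n]$ let $\theta(q)\in\arg\min_\theta \mathbb E_q[(Y-X^\top\theta)^2]$, $$\tilde F_1(q)=\sup_{E_v\in\mathcal E_4}\frac{E_v[\mathbb E_q[(v^\top X)^4]]}{E_v[\mathbb E_q[(v^\top X)^2]^2]},\qquad F_2(q)=\sup_{v\in\mathbb R^d}\frac{\mathbb E_q[(Y-X^\top\theta(q))^2(v^\top X)^2]}{\mathbb E_q[(v^\top X)^2]},$$ suprema being over $E_v$, $v$ with positive denominator. Here $\mathcal E_4$ is the set of degree-4 pseudoexpectations on the sphere: linear functionals $E$ on polynomials of degree $\le 4$ in $v$ with $E[1]=1$, and with $E[p^2]\ge0$ and $E[(\|v\|^2-1)p]=0$ for all $p$ of degree $\le2$. Write $\mathsf{TV}(p,q)=\sup_{A\subseteq[n]}(p(A)-q(A))$. *Algorithm.* Start from $q^{(0)}_i=1/n$. At step $k$, with $q=q^{(k)}$: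 if $\tilde F_1(q)\ge\kappa'^2$, take any $E_v\in\mathcal E_4$ with $E_v[\mathbb E_q[(v^\top X)^2]^2]>0$ and $E_v[\mathbb E_q[(v^\top X)^4]]\ge\kappa'^2E_v[\mathbb E_q[(v^\top X)^2]^2]$ and put $g_i=E_v[(v^\top X_i)^4]$; else, if $F_2(q)\ge\sigma'^2$, take any $v$ with $\mathbb E_q[(v^\top X)^2]>0$ at which the quotient in the definition of $F_2(q)$ is at least $\sigma'^2$ and at least $0.9\,F_2(q)$ (for instance a maximizer) and put $g_i=(Y_i-X_i^\top\theta(q))^2(v^\top X_i)^2$; else return $q$. If it has not returned, put $g_{\max}=\max\{g_i: q_i>0\}$, $\tilde q_i=q_i(1-g_i/g_{\max})$ and $q^{(k+1)}=\tilde q/\sum_j\tilde q_j$. *Claim.* There is an absolute constant $C$ such that the following holds whenever $\kappa\ge1$, $\sigma>0$, $\kappa^3\epsilon<1/64$, $\tilde F_1(p_S)\le\kappa^2$, $F_2(p_S)\le\sigma^2$, and $\kappa',\sigma'\ge0$ are given by $$\kappa'^2=\frac{2\kappa^2}{1-2\kappa^2\epsilon},\qquad \sigma'^2=\frac{4\sigma^2\bigl(1+2\kappa'\sqrt{\epsilon(1-\epsilon)}\bigr)}{(1-2\epsilon)^3-20\kappa'^3\epsilon(1-\epsilon)},$$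 the last denominator being positive. Whatever choices are made, the algorithm never gets stuck (as long as it has not returned, an admissible $E_v$ or $v$ exists), it returns after at most $C\epsilon n$ updates, and the distribution $q$ that it returns satisfies $$\tilde F_1(q)\le\kappa'^2,\qquad F_2(q)\le\sigma'^2,\qquad \mathsf{TV}(q,p_S)\le\frac{\epsilon}{1-\epsilon},$$ and, for every minimizer $\theta(q)$, $$\mathbb E_{p_S}[(Y-X^\top\theta(q))^2]-\mathbb E_{p_S}[(Y-X^\top\theta(p_S))^2]\le C(\kappa+\kappa')(\sigma+\sigma')^2\epsilon .$$ -/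

import Mathlib

open scoped BigOperators

namespace RobustLinReg

noncomputable section

/-- A data set: `n` covariates in `ℝ^d` (the responses are passed separately). -/
abbrev Covariates (n d : ℕ) := Fin n → EuclideanSpace ℝ (Fin d)

/-! ### Distributions supported on the data points -/

/-- The expectation of `f` under the distribution that gives mass `q i` to the `i`-th point. -/
def expect {n : ℕ} (q f : Fin n → ℝ) : ℝ := ∑ i, q i * f i

/-- The empirical distribution of all the points. -/
def unif (n : ℕ) : Fin n → ℝ := fun _ => 1 / (n : ℝ)

/-- The empirical distribution of the points with index in `S`. -/
def empirical {n : ℕ} (S : Finset (Fin n)) : Fin n → ℝ :=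
  fun i => if i ∈ S then 1 / (S.card : ℝ) else 0

/-- Total variation distance, `sup_A (p(A) - q(A))`. -/
def tv {n : ℕ} (p q : Fin n → ℝ) : ℝ :=
  ⨆ A : Finset (Fin n), ((∑ i ∈ A, p i) - ∑ i ∈ A, q i)

/-! ### Pseudoexpectations on the sphere and certifiable hypercontractivity -/

/-- `E` is a degree-`2k` pseudoexpectation on the unit sphere of `ℝ^d`. The map `E` is defined on
all polynomials for convenience, but only its values on polynomials of degree at most `2k` are
constrained and used; every linear functional on that subspace extends to all polynomials. -/
structure IsPseudoexpectation (d k : ℕ) (E : MvPolynomial (Fin d) ℝ →ₗ[ℝ] ℝ) : Prop where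
  map_one : E 1 = 1
  map_sq_nonneg : ∀ p : MvPolynomial (Fin d) ℝ, p.totalDegree ≤ k → 0 ≤ E (p ^ 2)
  map_sphere : ∀ p : MvPolynomial (Fin d) ℝ, p.totalDegree ≤ k →
    E (((∑ j, MvPolynomial.X j ^ 2) - 1) * p) = 0

/-- The polynomial `v ↦ vᵀ x`. -/
def linForm {d : ℕ} (x : EuclideanSpace ℝ (Fin d)) : MvPolynomial (Fin d) ℝ :=
  ∑ j, MvPolynomial.C (x j) * MvPolynomial.X j

/-- The polynomial `v ↦ 𝔼_q[(vᵀ X)^m]`. -/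
def momentPoly {n d : ℕ} (X : Covariates n d) (q : Fin n → ℝ) (m : ℕ) :
    MvPolynomial (Fin d) ℝ :=
  ∑ i, MvPolynomial.C (q i) * linForm (X i) ^ m

/-- `F̃₁(q)`, the supremum over degree-4 pseudoexpectations on the sphere of
`E_v[𝔼_q[(vᵀX)⁴]] / E_v[𝔼_q[(vᵀX)²]²]`. Pseudoexpectations with vanishing denominator are left
out: for a distribution `q` the numerator then vanishes as well. -/
def certHyper {n d : ℕ} (X : Covariates n d) (q : Fin n → ℝ) : EReal :=
  ⨆ (E : MvPolynomial (Fin d) ℝ →ₗ[ℝ] ℝ) (_ : IsPseudoexpectation d 2 E)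
    (_ : 0 < E (momentPoly X q 2 ^ 2)),
    ((E (momentPoly X q 4) / E (momentPoly X q 2 ^ 2) : ℝ) : EReal)

/-! ### Least squares and the bounded noise condition -/

/-- The residual `Y_i - X_iᵀ θ`. -/
def resid {n d : ℕ} (X : Covariates n d) (Y : Fin n → ℝ) (θ : EuclideanSpace ℝ (Fin d))
    (i : Fin n) : ℝ := Y i - inner ℝ θ (X i)

/-- `θ` minimizes `𝔼_q[(Y - Xᵀ θ)²]`. -/
def IsLeastSquares {n d : ℕ} (X : Covariates n d) (Y : Fin n → ℝ) (q : Fin n → ℝ)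
    (θ : EuclideanSpace ℝ (Fin d)) : Prop :=
  ∀ θ' : EuclideanSpace ℝ (Fin d),
    expect q (fun i => resid X Y θ i ^ 2) ≤ expect q (fun i => resid X Y θ' i ^ 2)

open Classical in
/-- `θ(q)`, a minimizer of `𝔼_q[(Y - Xᵀ θ)²]`. -/
def theta {n d : ℕ} (X : Covariates n d) (Y : Fin n → ℝ) (q : Fin n → ℝ) :
    EuclideanSpace ℝ (Fin d) :=
  if h : ∃ θ, IsLeastSquares X Y q θ then h.choose else 0

/-- For nonnegative weights a least-squares solution exists. -/
theorem exists_isLeastSquares {n d : ℕ} (X : Covariates n d) (Y : Fin n → ℝ) (q : Fin n → ℝ)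
    (hq : ∀ i, 0 ≤ q i) : ∃ θ, IsLeastSquares X Y q θ := by
  let L : EuclideanSpace ℝ (Fin d) →ₗ[ℝ] EuclideanSpace ℝ (Fin n) :=
    { toFun := fun θ => WithLp.toLp 2 (fun i => Real.sqrt (q i) * inner ℝ θ (X i))
      map_add' := fun a b => by
        ext i; simp [inner_add_left, mul_add]
      map_smul' := fun c a => by
        ext i; simp [inner_smul_left]; ring }
  let y : EuclideanSpace ℝ (Fin n) := WithLp.toLp 2 (fun i => Real.sqrt (q i) * Y i)
  have key : ∀ θ, ‖y - L θ‖ ^ 2 = expect q (fun i => resid X Y θ i ^ 2) := by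
    intro θ
    rw [EuclideanSpace.norm_sq_eq]
    unfold expect resid
    refine Finset.sum_congr rfl fun i _ => ?_
    simp only [y, L, PiLp.sub_apply, LinearMap.coe_mk, AddHom.coe_mk, Real.norm_eq_abs, sq_abs]
    rw [← mul_sub, mul_pow, Real.sq_sqrt (hq i)]
  obtain ⟨w, hw, hmin⟩ := Submodule.exists_norm_eq_iInf_of_complete_subspace
    (LinearMap.range L) (Submodule.complete_of_finiteDimensional _) y
  obtain ⟨θ, rfl⟩ := hw
  refine ⟨θ, fun θ' => ?_⟩
  rw [← key, ← key]
  have h : ‖y - L θ‖ ≤ ‖y - L θ'‖ := by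
    rw [hmin]
    exact ciInf_le ⟨0, by rintro _ ⟨z, rfl⟩; exact norm_nonneg _⟩
      (⟨L θ', LinearMap.mem_range_self L θ'⟩ : LinearMap.range L)
  gcongr

theorem theta_isLeastSquares {n d : ℕ} (X : Covariates n d) (Y : Fin n → ℝ) (q : Fin n → ℝ)
    (hq : ∀ i, 0 ≤ q i) : IsLeastSquares X Y q (theta X Y q) := by
  have h := exists_isLeastSquares X Y q hq
  unfold theta
  rw [dif_pos h]
  exact h.choose_spec

/-- `𝔼_q[(vᵀX)²]`. -/
def secondMoment {n d : ℕ} (X : Covariates n d) (q : Fin n → ℝ)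
    (v : EuclideanSpace ℝ (Fin d)) : ℝ :=
  expect q (fun i => (inner ℝ v (X i)) ^ 2)

/-- `𝔼_q[(Y - Xᵀ θ(q))² (vᵀX)²]`. -/
def noiseMoment {n d : ℕ} (X : Covariates n d) (Y : Fin n → ℝ) (q : Fin n → ℝ)
    (v : EuclideanSpace ℝ (Fin d)) : ℝ :=
  expect q (fun i => resid X Y (theta X Y q) i ^ 2 * (inner ℝ v (X i)) ^ 2)

/-- `F₂(q) = sup_v 𝔼_q[(Y - Xᵀ θ(q))² (vᵀX)²] / 𝔼_q[(vᵀX)²]`. Directions with vanishing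
denominator are left out: for a distribution `q` the numerator then vanishes as well. The value
does not depend on which minimizer `θ(q)` is used. -/
def boundedNoise {n d : ℕ} (X : Covariates n d) (Y : Fin n → ℝ) (q : Fin n → ℝ) : EReal :=
  ⨆ (v : EuclideanSpace ℝ (Fin d)) (_ : 0 < secondMoment X q v),
    ((noiseMoment X Y q v / secondMoment X q v : ℝ) : EReal)

/-! ### The quasi-gradients -/

/-- `g₁(X_i; q) = E_v[(vᵀ X_i)⁴]`. -/
def grad₁ {n d : ℕ} (X : Covariates n d) (E : MvPolynomial (Fin d) ℝ →ₗ[ℝ] ℝ) (i : Fin n) : ℝ :=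
  E (linForm (X i) ^ 4)

/-- The pseudoexpectations that may be used in `g₁( · ; q)`. -/
def Admissible₁ {n d : ℕ} (X : Covariates n d) (κ' : ℝ) (q : Fin n → ℝ)
    (E : MvPolynomial (Fin d) ℝ →ₗ[ℝ] ℝ) : Prop :=
  IsPseudoexpectation d 2 E ∧ 0 < E (momentPoly X q 2 ^ 2) ∧
    κ' ^ 2 * E (momentPoly X q 2 ^ 2) ≤ E (momentPoly X q 4)

/-- `g₂(X_i; q) = (Y_i - X_iᵀ θ(q))² (vᵀ X_i)²`. -/
def grad₂ {n d : ℕ} (X : Covariates n d) (Y : Fin n → ℝ) (q : Fin n → ℝ)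
    (v : EuclideanSpace ℝ (Fin d)) (i : Fin n) : ℝ :=
  resid X Y (theta X Y q) i ^ 2 * (inner ℝ v (X i)) ^ 2

/-- The directions that may be used in `g₂( · ; q)`: the quotient defining `F₂(q)` is at least
`σ'²` at `v`, and `v` maximizes it up to the factor `0.9`. -/
def Admissible₂ {n d : ℕ} (X : Covariates n d) (Y : Fin n → ℝ) (σ' : ℝ) (q : Fin n → ℝ)
    (v : EuclideanSpace ℝ (Fin d)) : Prop :=
  0 < secondMoment X q v ∧ σ' ^ 2 * secondMoment X q v ≤ noiseMoment X Y q v ∧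
    ∀ w : EuclideanSpace ℝ (Fin d), 0 < secondMoment X q w →
      (9 / 10) * (noiseMoment X Y q w / secondMoment X q w) ≤
        noiseMoment X Y q v / secondMoment X q v

/-! ### The filter algorithm -/

/-- The largest value of `g` over the points that still carry mass. -/
def gmax {n : ℕ} (q g : Fin n → ℝ) : ℝ := ⨆ i : {i : Fin n // 0 < q i}, g i

/-- `q̃_i = q_i (1 - η g_i)` with `η = 1 / g_max`. -/
def downweight {n : ℕ} (q g : Fin n → ℝ) : Fin n → ℝ := fun i => q i * (1 - 1 / gmax q g * g i)

/-- One update: downweight and renormalize. -/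
def update {n : ℕ} (q g : Fin n → ℝ) : Fin n → ℝ :=
  fun i => downweight q g i / ∑ j, downweight q g j

/-- One pass through the loop of the algorithm that does not return, for some admissible choice of
the pseudoexpectation or of the direction. -/
inductive Step {n d : ℕ} (X : Covariates n d) (Y : Fin n → ℝ) (κ' σ' : ℝ) :
    (Fin n → ℝ) → (Fin n → ℝ) → Prop
  | hyper (q : Fin n → ℝ) (E : MvPolynomial (Fin d) ℝ →ₗ[ℝ] ℝ)
      (h₁ : ((κ' ^ 2 : ℝ) : EReal) ≤ certHyper X q) (hE : Admissible₁ X κ' q E) :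
      Step X Y κ' σ' q (update q (grad₁ X E))
  | noise (q : Fin n → ℝ) (v : EuclideanSpace ℝ (Fin d))
      (h₁ : ¬ ((κ' ^ 2 : ℝ) : EReal) ≤ certHyper X q)
      (h₂ : ((σ' ^ 2 : ℝ) : EReal) ≤ boundedNoise X Y q) (hv : Admissible₂ X Y σ' q v) :
      Step X Y κ' σ' q (update q (grad₂ X Y q v))

/-- The algorithm returns at `q`: both tests fail. -/
def Returns {n d : ℕ} (X : Covariates n d) (Y : Fin n → ℝ) (κ' σ' : ℝ) (q : Fin n → ℝ) : Prop :=
  ¬ ((κ' ^ 2 : ℝ) : EReal) ≤ certHyper X q ∧ ¬ ((σ' ^ 2 : ℝ) : EReal) ≤ boundedNoise X Y q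

/-- `Reaches X Y κ' σ' k q`: some execution of the algorithm, started at the uniform distribution,
has `q` as its iterate `q⁽ᵏ⁾`. -/
inductive Reaches {n d : ℕ} (X : Covariates n d) (Y : Fin n → ℝ) (κ' σ' : ℝ) :
    ℕ → (Fin n → ℝ) → Prop
  | init : Reaches X Y κ' σ' 0 (unif n)
  | step {k : ℕ} {q q' : Fin n → ℝ} (h : Reaches X Y κ' σ' k q) (hs : Step X Y κ' σ' q q') :
      Reaches X Y κ' σ' (k + 1) q'

end

end RobustLinReg

open RobustLinReg

/-!
Every iterate of the algorithm is proportional to weights `w : Fin n → [0, 1]` that have removed at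
most as much mass from the good points `S` as from the others (`IsFilterWeight`). This keeps the
iterate within total variation distance `ε / (1 - ε)` of `p_S`, and since each update sets a new
weight to zero and at most `2εn` of the total weight `n` is ever removed, there are at most `2εn`
updates. An update preserves the invariant when the good points carry at most half of `𝔼_q[g]`.

* For the pseudoexpectation filter (`two_mul_sum_grad₁_le`), split the fourth moment under `p_S`
  into the part that is left and the part that was removed. If the removed part is large, it uses up
  the budget `κ²` of `p_S`; if it is small, then, by Cauchy–Schwarz for pseudoexpectations, so is
  its contribution to the second moment (`fourth_moment_tradeoff`).
* For the noise filter (`two_mul_sum_grad₂_le`), both `p_S` and `q` are hypercontractive. On the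
  common part `min(p_S, q)` the normal equations for `θ(p_S)` and `θ(q)` turn the second moment
  in the direction `θ(q) - θ(p_S)` into sums over the two differences `p_S - min` and
  `q - min`, each of mass at most `ε / (1 - ε)`, and Cauchy–Schwarz with the noise bounds of `p_S` and of `q`
  controls these (`secondMoment_min_le`, `secondMoment_sub_le`). Under `q` the noise bound is
  `10/9` of the quotient at the chosen direction. The residuals of `θ(q)` on `S` are then close to
  those of `θ(p_S)`. The same distance bound gives the excess loss at the end (`excess_le`).

The algorithm does not get stuck because both suprema are attained. For `F₂` the quotient is a
continuous function on the unit sphere of a finite-dimensional space. For `F̃₁` the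
pseudoexpectations form a compact set, but the denominator may tend to zero when the covariates do
not span `ℝ^d`. Restricting a pseudoexpectation to the span of the covariates (a linear
substitution, then homogenization to get back to the sphere) keeps the quotient and bounds the
denominator below (`exists_map_momentPoly_ge`).
-/

namespace RobustLinReg

/-! ### Quartic functionals that are nonnegative on squares of quadratics -/

section Quartic

variable {n d : ℕ} {E : MvPolynomial (Fin d) ℝ →ₗ[ℝ] ℝ}

/-- `E` is nonnegative on squares of polynomials of degree at most `2`: a degree-4
pseudoexpectation without the normalization and without the sphere constraint. -/
def SqNonneg (E : MvPolynomial (Fin d) ℝ →ₗ[ℝ] ℝ) : Prop :=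
  ∀ p : MvPolynomial (Fin d) ℝ, p.totalDegree ≤ 2 → 0 ≤ E (p ^ 2)

/-- Cauchy–Schwarz for a functional that is nonnegative on squares. -/
theorem map_mul_sq_le (hE : SqNonneg E)
    {f g : MvPolynomial (Fin d) ℝ} (hf : f.totalDegree ≤ 2) (hg : g.totalDegree ≤ 2) :
    E (f * g) ^ 2 ≤ E (f ^ 2) * E (g ^ 2) := by
  have key : ∀ t : ℝ, 0 ≤ E (g ^ 2) * (t * t) + 2 * E (f * g) * t + E (f ^ 2) := by
    intro t
    have h1 : (f + t • g).totalDegree ≤ 2 :=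
      (MvPolynomial.totalDegree_add _ _).trans
        (max_le hf ((MvPolynomial.totalDegree_smul_le _ _).trans hg))
    have h2 := hE _ h1
    have h3 : (f + t • g) ^ 2 = f ^ 2 + (2 * t) • (f * g) + (t * t) • g ^ 2 := by
      simp only [Algebra.smul_def, map_mul, map_ofNat]; ring
    rw [h3] at h2
    simp only [map_add, map_smul, smul_eq_mul] at h2
    linarith
  have := discrim_le_zero key
  unfold discrim at this
  nlinarith

theorem abs_map_mul_le_half_add (hE : SqNonneg E)
    {f g : MvPolynomial (Fin d) ℝ} (hf : f.totalDegree ≤ 2) (hg : g.totalDegree ≤ 2) :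
    |E (f * g)| ≤ (E (f ^ 2) + E (g ^ 2)) / 2 := by
  have h := map_mul_sq_le hE hf hg
  have h1 := hE f hf
  have h2 := hE g hg
  apply abs_le_of_sq_le_sq _ (by linarith)
  nlinarith [sq_nonneg (E (f ^ 2) - E (g ^ 2))]

theorem linForm_isHomogeneous (x : EuclideanSpace ℝ (Fin d)) : (linForm x).IsHomogeneous 1 :=
  MvPolynomial.IsHomogeneous.sum _ _ _ fun _ _ => MvPolynomial.isHomogeneous_C_mul_X _ _

theorem totalDegree_linForm_mul_le (x y : EuclideanSpace ℝ (Fin d)) :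
    (linForm x * linForm y).totalDegree ≤ 2 :=
  ((linForm_isHomogeneous x).mul (linForm_isHomogeneous y)).totalDegree_le

theorem momentPoly_isHomogeneous (X : Covariates n d) (q : Fin n → ℝ) (m : ℕ) :
    (momentPoly X q m).IsHomogeneous m :=
  MvPolynomial.IsHomogeneous.sum _ _ _ fun i _ => by
    simpa using ((linForm_isHomogeneous (X i)).pow m).C_mul (q i)

theorem momentPoly_add (X : Covariates n d) (a b : Fin n → ℝ) (m : ℕ) :
    momentPoly X (a + b) m = momentPoly X a m + momentPoly X b m := by
  simp [momentPoly, add_mul, Finset.sum_add_distrib]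

theorem momentPoly_smul (X : Covariates n d) (c : ℝ) (a : Fin n → ℝ) (m : ℕ) :
    momentPoly X (c • a) m = c • momentPoly X a m := by
  simp [momentPoly, MvPolynomial.smul_eq_C_mul, Finset.mul_sum, mul_assoc]

/-- The pseudo-moment `E_v[(vᵀX_i)² (vᵀX_j)²]`. -/
noncomputable def crossMoment (X : Covariates n d) (E : MvPolynomial (Fin d) ℝ →ₗ[ℝ] ℝ)
    (i j : Fin n) : ℝ :=
  E ((linForm (X i) * linForm (X j)) ^ 2)

theorem map_momentPoly_four (X : Covariates n d) (q : Fin n → ℝ) :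
    E (momentPoly X q 4) = ∑ i, q i * grad₁ X E i := by
  simp [momentPoly, grad₁, map_sum, ← MvPolynomial.smul_eq_C_mul]

theorem map_momentPoly_two_mul (X : Covariates n d) (a b : Fin n → ℝ) :
    E (momentPoly X a 2 * momentPoly X b 2) = ∑ i, ∑ j, a i * b j * crossMoment X E i j := by
  rw [momentPoly, momentPoly, Finset.sum_mul_sum, map_sum]
  refine Finset.sum_congr rfl fun i _ => ?_
  rw [map_sum]
  refine Finset.sum_congr rfl fun j _ => ?_
  rw [crossMoment, ← smul_eq_mul (a := a i * b j), ← map_smul, MvPolynomial.smul_eq_C_mul,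
    MvPolynomial.C_mul]
  congr 1; ring

theorem crossMoment_nonneg (hE : SqNonneg E) (X : Covariates n d) (i j : Fin n) :
    0 ≤ crossMoment X E i j :=
  hE _ (totalDegree_linForm_mul_le _ _)

theorem grad₁_nonneg (hE : SqNonneg E) (X : Covariates n d) (i : Fin n) : 0 ≤ grad₁ X E i := by
  have := hE _ (totalDegree_linForm_mul_le (X i) (X i))
  rwa [show (linForm (X i) * linForm (X i)) ^ 2 = linForm (X i) ^ 4 by ring] at this

theorem crossMoment_le (hE : SqNonneg E) (X : Covariates n d) (i j : Fin n) :
    crossMoment X E i j ≤ (grad₁ X E i + grad₁ X E j) / 2 := by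
  have := (le_abs_self _).trans (abs_map_mul_le_half_add hE (totalDegree_linForm_mul_le (X i) (X i))
    (totalDegree_linForm_mul_le (X j) (X j)))
  have hsq : ∀ k, (linForm (X k) * linForm (X k)) ^ 2 = linForm (X k) ^ 4 := fun k => by ring
  rw [hsq, hsq] at this
  rwa [crossMoment, show (linForm (X i) * linForm (X j)) ^ 2
    = linForm (X i) * linForm (X i) * (linForm (X j) * linForm (X j)) by ring]

theorem map_momentPoly_two_mul_le (hE : SqNonneg E) (X : Covariates n d) {a b a' b' : Fin n → ℝ}
    (ha : ∀ i, 0 ≤ a i) (hb : ∀ i, 0 ≤ b i) (haa : ∀ i, a i ≤ a' i) (hbb : ∀ i, b i ≤ b' i) :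
    E (momentPoly X a 2 * momentPoly X b 2) ≤ E (momentPoly X a' 2 * momentPoly X b' 2) := by
  rw [map_momentPoly_two_mul, map_momentPoly_two_mul]
  refine Finset.sum_le_sum fun i _ => Finset.sum_le_sum fun j _ => ?_
  exact mul_le_mul_of_nonneg_right
    (mul_le_mul (haa i) (hbb j) (hb j) ((ha i).trans (haa i))) (crossMoment_nonneg hE X i j)

/-- A weighted second moment is small when the total weight is small. -/
theorem map_momentPoly_two_sq_le (hE : SqNonneg E) (X : Covariates n d) {a : Fin n → ℝ}
    (ha : ∀ i, 0 ≤ a i) :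
    E (momentPoly X a 2 ^ 2) ≤ (∑ i, a i) * E (momentPoly X a 4) := by
  rw [sq, map_momentPoly_two_mul, map_momentPoly_four]
  have h1 : ∑ i, ∑ j, a i * a j * crossMoment X E i j
      ≤ ∑ i, ∑ j, (a i * (a j * grad₁ X E j) + a i * grad₁ X E i * a j) / 2 := by
    refine Finset.sum_le_sum fun i _ => Finset.sum_le_sum fun j _ => ?_
    have := mul_le_mul_of_nonneg_left (crossMoment_le hE X i j) (mul_nonneg (ha i) (ha j))
    linarith
  refine h1.trans (le_of_eq ?_)
  simp_rw [← Finset.sum_div, Finset.sum_add_distrib, ← Finset.sum_mul_sum]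
  ring

/-- When the denominator in `F̃₁` vanishes, so does the numerator. -/
theorem map_momentPoly_four_eq_zero (hE : SqNonneg E) (X : Covariates n d) {q : Fin n → ℝ}
    (hq : ∀ i, 0 ≤ q i) (h0 : E (momentPoly X q 2 ^ 2) = 0) : E (momentPoly X q 4) = 0 := by
  rw [sq, map_momentPoly_two_mul] at h0
  have hnn : ∀ i j, 0 ≤ q i * q j * crossMoment X E i j := fun i j =>
    mul_nonneg (mul_nonneg (hq i) (hq j)) (crossMoment_nonneg hE X i j)
  rw [map_momentPoly_four]
  refine Finset.sum_eq_zero fun i _ => ?_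
  have h1 := (Finset.sum_eq_zero_iff_of_nonneg
    (fun i _ => Finset.sum_nonneg fun j _ => hnn i j)).1 h0 i (Finset.mem_univ _)
  have h2 := (Finset.sum_eq_zero_iff_of_nonneg (fun j _ => hnn i j)).1 h1 i (Finset.mem_univ _)
  have h3 : crossMoment X E i i = grad₁ X E i := by
    rw [crossMoment, grad₁]; congr 1; ring
  rw [h3] at h2
  rcases mul_eq_zero.1 h2 with h | h
  · rw [mul_self_eq_zero.1 h, zero_mul]
  · rw [h, mul_zero]

end Quartic

/-! ### Certified hypercontractivity -/

section Hyper

variable {n d : ℕ}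

theorem map_momentPoly_four_le_of_certHyper_le (X : Covariates n d) {q : Fin n → ℝ}
    (hq : ∀ i, 0 ≤ q i) {c : ℝ} (h : certHyper X q ≤ (c : EReal))
    {E : MvPolynomial (Fin d) ℝ →ₗ[ℝ] ℝ} (hE : IsPseudoexpectation d 2 E) :
    E (momentPoly X q 4) ≤ c * E (momentPoly X q 2 ^ 2) := by
  rcases (hE.map_sq_nonneg _ (momentPoly_isHomogeneous X q 2).totalDegree_le).eq_or_lt with h0 | h0
  · rw [map_momentPoly_four_eq_zero hE.map_sq_nonneg X hq h0.symm, ← h0, mul_zero]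
  · have h1 : ((E (momentPoly X q 4) / E (momentPoly X q 2 ^ 2) : ℝ) : EReal) ≤ certHyper X q := by
      unfold certHyper
      exact le_iSup_of_le E (le_iSup_of_le hE (le_iSup_of_le h0 le_rfl))
    exact (div_le_iff₀ h0).1 (EReal.coe_le_coe_iff.1 (h1.trans h))

theorem aeval_linForm (v x : EuclideanSpace ℝ (Fin d)) :
    MvPolynomial.aeval (fun j => v j) (linForm x) = inner ℝ v x := by
  simp [linForm, PiLp.inner_apply]

/-- Evaluation at a unit vector is a pseudoexpectation. -/
theorem isPseudoexpectation_aeval {v : EuclideanSpace ℝ (Fin d)} (hv : ‖v‖ = 1) (k : ℕ) :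
    IsPseudoexpectation d k
      (MvPolynomial.aeval (R := ℝ) (fun j => v j) :
        MvPolynomial (Fin d) ℝ →ₐ[ℝ] ℝ).toLinearMap where
  map_one := by simp
  map_sq_nonneg p _ := by simp [sq_nonneg]
  map_sphere p _ := by
    have : ∑ j, v j ^ 2 = 1 := by
      have := EuclideanSpace.real_norm_sq_eq v
      rw [hv] at this; linarith
    simp [this]

/-- Certified hypercontractivity implies hypercontractivity in every direction. -/
theorem expect_pow_four_le_of_certHyper_le (X : Covariates n d) {q : Fin n → ℝ}
    (hq : ∀ i, 0 ≤ q i) {c : ℝ} (h : certHyper X q ≤ (c : EReal))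
    (v : EuclideanSpace ℝ (Fin d)) :
    expect q (fun i => (inner ℝ v (X i)) ^ 4) ≤ c * secondMoment X q v ^ 2 := by
  rcases eq_or_ne v 0 with rfl | hv
  · simp [expect, secondMoment]
  have hv' : ‖v‖ ≠ 0 := norm_ne_zero_iff.2 hv
  set u : EuclideanSpace ℝ (Fin d) := ‖v‖⁻¹ • v with hu
  have hun : ‖u‖ = 1 := by rw [hu, norm_smul, norm_inv, norm_norm, inv_mul_cancel₀ hv']
  have hvu : v = ‖v‖ • u := by rw [hu, smul_smul, mul_inv_cancel₀ hv', one_smul]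
  have h1 := map_momentPoly_four_le_of_certHyper_le X hq h (isPseudoexpectation_aeval hun 2)
  simp only [momentPoly, AlgHom.toLinearMap_apply, map_sum, map_mul, map_pow, aeval_linForm,
    MvPolynomial.aeval_C, Algebra.algebraMap_self, RingHom.id_apply] at h1
  have h2 : expect q (fun i => (inner ℝ v (X i)) ^ 4)
      = ‖v‖ ^ 4 * ∑ i, q i * (inner ℝ u (X i)) ^ 4 := by
    rw [expect, Finset.mul_sum]
    refine Finset.sum_congr rfl fun i _ => ?_
    rw [hvu, inner_smul_left, ← hvu]; simp; ring
  have h3 : secondMoment X q v = ‖v‖ ^ 2 * ∑ i, q i * (inner ℝ u (X i)) ^ 2 := by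
    rw [secondMoment, expect, Finset.mul_sum]
    refine Finset.sum_congr rfl fun i _ => ?_
    rw [hvu, inner_smul_left, ← hvu]; simp; ring
  rw [h2, h3]
  nlinarith [mul_le_mul_of_nonneg_left h1 (by positivity : 0 ≤ ‖v‖ ^ 4)]

end Hyper

/-! ### Restricting a pseudoexpectation to the span of the covariates -/

section Restrict

variable {n d : ℕ}

theorem linForm_smul (c : ℝ) (x : EuclideanSpace ℝ (Fin d)) :
    linForm (c • x) = c • linForm x := by
  simp [linForm, MvPolynomial.smul_eq_C_mul, Finset.mul_sum, mul_assoc]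

theorem linForm_sum {ι : Type*} (s : Finset ι) (x : ι → EuclideanSpace ℝ (Fin d)) :
    linForm (∑ i ∈ s, x i) = ∑ i ∈ s, linForm (x i) := by
  simp only [linForm, WithLp.ofLp_sum, Finset.sum_apply, map_sum, Finset.sum_mul]
  exact Finset.sum_comm

/-- The linear map of `ℝ^d` with the rows `β_a = ∑ i, α_i(a) √q_i X_i`, for suitable `α`, leaves
`vᵀX_k` unchanged for every point `k` that carries mass. It projects to a complement of the
directions `v` in which all these forms vanish. -/
theorem exists_section (X : Covariates n d) (q : Fin n → ℝ) :
    ∃ α : Fin n → EuclideanSpace ℝ (Fin d), ∀ k, 0 < q k →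
      ∑ a, X k a • ∑ i, (α i a * √(q i)) • X i = X k := by
  let T : EuclideanSpace ℝ (Fin d) →ₗ[ℝ] (Fin n → ℝ) :=
    { toFun := fun v i => √(q i) * inner ℝ v (X i)
      map_add' := fun a b => by ext i; simp [inner_add_left, mul_add]
      map_smul' := fun c a => by ext i; simp [inner_smul_left]; ring }
  -- `G` is a generalized inverse of `T`, that is, `T ∘ G ∘ T = T`.
  obtain ⟨s, hs⟩ := T.rangeRestrict.exists_rightInverse_of_surjective T.range_rangeRestrict
  obtain ⟨G, hG⟩ := s.exists_extend
  have hTGT : ∀ v, T (G (T v)) = T v := by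
    intro v
    have h1 : G (T v) = s (T.rangeRestrict v) := by
      rw [← hG]; rfl
    have h2 := LinearMap.congr_fun hs (T.rangeRestrict v)
    rw [h1]
    exact congrArg Subtype.val h2
  refine ⟨fun i => G (Pi.single i 1), fun k hk => ext_inner_left ℝ fun v => ?_⟩
  have h3 := congrFun (hTGT v) k
  have h4 : G (T v) = ∑ i, (T v i) • G (Pi.single i 1) := by
    conv_lhs => rw [← Finset.univ_sum_single (T v)]
    rw [map_sum]
    refine Finset.sum_congr rfl fun i _ => ?_
    rw [← map_smul]; congr 1; ext j; simp [Pi.single_apply]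
  have h5 : inner ℝ (G (T v)) (X k) = inner ℝ v (X k) :=
    mul_left_cancel₀ (Real.sqrt_pos.2 hk).ne' h3
  rw [← h5, h4, sum_inner]
  simp only [inner_sum, inner_smul_right, inner_smul_left, Finset.mul_sum, PiLp.inner_apply (G _),
    RCLike.inner_apply, conj_trivial]
  rw [Finset.sum_comm]
  refine Finset.sum_congr rfl fun i _ => Finset.sum_congr rfl fun a _ => ?_
  simp only [T, LinearMap.coe_mk, AddHom.coe_mk]
  ring

theorem sum_sq_sub_mul_eq {ι R : Type*} [CommRing R] (s : Finset ι) (a b : ι → R) :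
    ∑ i ∈ s, ∑ j ∈ s, (a i * b j - a j * b i) ^ 2
      = 2 * ((∑ i ∈ s, a i ^ 2) * ∑ i ∈ s, b i ^ 2) - 2 * (∑ i ∈ s, a i * b i) ^ 2 := by
  have h1 : ∀ i j, (a i * b j - a j * b i) ^ 2
      = a i ^ 2 * b j ^ 2 + b i ^ 2 * a j ^ 2 - 2 * ((a i * b i) * (a j * b j)) :=
    fun i j => by ring
  simp only [h1, Finset.sum_sub_distrib, Finset.sum_add_distrib, ← Finset.mul_sum,
    ← Finset.sum_mul]
  ring

theorem sum_linForm_sq_isHomogeneous {ι : Type*} (s : Finset ι)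
    (x : ι → EuclideanSpace ℝ (Fin d)) : (∑ i ∈ s, linForm (x i) ^ 2).IsHomogeneous 2 :=
  MvPolynomial.IsHomogeneous.sum _ _ _ fun i _ => by
    simpa using (linForm_isHomogeneous (x i)).pow 2

theorem map_sum_sq_le_add {E : MvPolynomial (Fin d) ℝ →ₗ[ℝ] ℝ} (hE : SqNonneg E)
    {ι ι' : Type*} (s : Finset ι) (t : Finset ι')
    (x : ι → EuclideanSpace ℝ (Fin d)) (y : ι' → EuclideanSpace ℝ (Fin d)) :
    E ((∑ i ∈ s, linForm (x i) ^ 2) ^ 2)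
      ≤ E ((∑ i ∈ s, linForm (x i) ^ 2 + ∑ i ∈ t, linForm (y i) ^ 2) ^ 2) := by
  have h1 : 0 ≤ E ((∑ i ∈ s, linForm (x i) ^ 2) * ∑ i ∈ t, linForm (y i) ^ 2) := by
    rw [Finset.sum_mul_sum, map_sum]
    refine Finset.sum_nonneg fun i _ => ?_
    rw [map_sum]
    refine Finset.sum_nonneg fun j _ => ?_
    rw [← mul_pow]
    exact hE _ (totalDegree_linForm_mul_le _ _)
  have h2 := hE _ (sum_linForm_sq_isHomogeneous t y).totalDegree_le
  rw [add_sq, map_add, map_add, mul_assoc, two_mul, map_add]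
  linarith

/-- The substitution `v_a ↦ vᵀβ_a`. -/
noncomputable def substForm (β : Fin d → EuclideanSpace ℝ (Fin d)) :
    MvPolynomial (Fin d) ℝ →ₐ[ℝ] MvPolynomial (Fin d) ℝ :=
  MvPolynomial.aeval fun a => linForm (β a)

theorem substForm_linForm (β : Fin d → EuclideanSpace ℝ (Fin d)) (x : EuclideanSpace ℝ (Fin d)) :
    substForm β (linForm x) = linForm (∑ a, x a • β a) := by
  rw [linForm_sum]
  simp only [linForm_smul]
  conv_lhs => rw [linForm]
  simp [substForm, MvPolynomial.smul_eq_C_mul]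

theorem substForm_isHomogeneous (β : Fin d → EuclideanSpace ℝ (Fin d))
    {p : MvPolynomial (Fin d) ℝ} {k : ℕ} (hp : p.IsHomogeneous k) :
    (substForm β p).IsHomogeneous k := by
  simpa [substForm] using hp.aeval _ (n := 1) fun a => linForm_isHomogeneous (β a)

theorem exists_homogeneous_decomp {p : MvPolynomial (Fin d) ℝ} (hp : p.totalDegree ≤ 2) :
    ∃ p₀ p₁ p₂ : MvPolynomial (Fin d) ℝ, p₀.IsHomogeneous 0 ∧ p₁.IsHomogeneous 1 ∧
      p₂.IsHomogeneous 2 ∧ p = p₀ + p₁ + p₂ := by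
  refine ⟨_, _, _, MvPolynomial.homogeneousComponent_isHomogeneous 0 p,
    MvPolynomial.homogeneousComponent_isHomogeneous 1 p,
    MvPolynomial.homogeneousComponent_isHomogeneous 2 p, ?_⟩
  have h1 : ∑ i ∈ Finset.range 3, MvPolynomial.homogeneousComponent i p
      = ∑ i ∈ Finset.range (p.totalDegree + 1), MvPolynomial.homogeneousComponent i p := by
    symm
    refine Finset.sum_subset (Finset.range_subset_range.2 (by omega)) fun i _ hi => ?_
    exact MvPolynomial.homogeneousComponent_eq_zero _ _ (by
      simp only [Finset.mem_range] at hi; omega)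
  rw [MvPolynomial.sum_homogeneousComponent] at h1
  simpa [Finset.sum_range_succ] using h1.symm

theorem sqNonneg_comp_substForm {E : MvPolynomial (Fin d) ℝ →ₗ[ℝ] ℝ} (hE : SqNonneg E)
    (β : Fin d → EuclideanSpace ℝ (Fin d)) : SqNonneg (E ∘ₗ (substForm β).toLinearMap) := by
  intro p hp
  obtain ⟨p₀, p₁, p₂, h0, h1, h2, rfl⟩ := exists_homogeneous_decomp hp
  simp only [LinearMap.comp_apply, AlgHom.toLinearMap_apply, map_pow]
  apply hE
  simp only [map_add]
  refine (MvPolynomial.totalDegree_add _ _).trans (max_le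
    ((MvPolynomial.totalDegree_add _ _).trans (max_le ?_ ?_)) ?_)
  · exact (substForm_isHomogeneous β h0).totalDegree_le.trans (by norm_num)
  · exact (substForm_isHomogeneous β h1).totalDegree_le.trans (by norm_num)
  · exact (substForm_isHomogeneous β h2).totalDegree_le

/-- The polynomial `‖v‖²`. -/
noncomputable def normSqPoly (d : ℕ) : MvPolynomial (Fin d) ℝ := ∑ j, MvPolynomial.X j ^ 2

theorem normSqPoly_isHomogeneous : (normSqPoly d).IsHomogeneous 2 :=
  MvPolynomial.IsHomogeneous.sum _ _ _ fun i _ => by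
    simpa using (MvPolynomial.isHomogeneous_X ℝ i).pow 2

theorem momentPoly_two_eq_sum (X : Covariates n d) {q : Fin n → ℝ} (hq : ∀ i, 0 ≤ q i) :
    momentPoly X q 2 = ∑ i, linForm (√(q i) • X i) ^ 2 := by
  refine Finset.sum_congr rfl fun i _ => ?_
  simp only [linForm_smul, MvPolynomial.smul_eq_C_mul, mul_pow, ← map_pow, Real.sq_sqrt (hq i)]

theorem normSqPoly_eq_sum :
    normSqPoly d = ∑ a, linForm (EuclideanSpace.single a (1 : ℝ)) ^ 2 := by
  refine Finset.sum_congr rfl fun a _ => ?_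
  simp [linForm, apply_ite MvPolynomial.C, PiLp.single_apply]

/-- Cauchy–Schwarz for sums of squares of linear forms: the difference of the two quadratics is
a sum of squares by Lagrange's identity, so the bound holds under pseudoexpectations. -/
theorem map_sum_linForm_sq_le {E : MvPolynomial (Fin d) ℝ →ₗ[ℝ] ℝ} (hE : SqNonneg E)
    {ι κ : Type*} [Fintype ι] [Fintype κ] (s : ι → EuclideanSpace ℝ (Fin d)) (c : κ → ι → ℝ) :
    E ((∑ a, linForm (∑ i, c a i • s i) ^ 2) ^ 2)
      ≤ (∑ a, ∑ i, c a i ^ 2) ^ 2 * E ((∑ i, linForm (s i) ^ 2) ^ 2) := by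
  have hcs : ∀ a, linForm (∑ i, c a i • s i) = ∑ i, MvPolynomial.C (c a i) * linForm (s i) := by
    intro a
    simp only [linForm_sum, linForm_smul, MvPolynomial.smul_eq_C_mul]
  let y : κ × ι × ι → EuclideanSpace ℝ (Fin d) := fun t =>
    (√2)⁻¹ • (c t.1 t.2.1 • s t.2.2 - c t.1 t.2.2 • s t.2.1)
  have hlin : ∀ x y : EuclideanSpace ℝ (Fin d), linForm (x - y) = linForm x - linForm y := by
    intro x y
    simp [linForm, sub_mul]
  have hsum : ∑ a, linForm (∑ i, c a i • s i) ^ 2 + ∑ t, linForm (y t) ^ 2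
      = (∑ a, ∑ i, c a i ^ 2) • ∑ i, linForm (s i) ^ 2 := by
    rw [Fintype.sum_prod_type, ← Finset.sum_add_distrib, Finset.sum_smul]
    refine Finset.sum_congr rfl fun a _ => ?_
    rw [Fintype.sum_prod_type]
    have h1 := sum_sq_sub_mul_eq Finset.univ (fun i => MvPolynomial.C (c a i))
      (fun i => linForm (s i))
    have h2 : ∀ i j, linForm (y (a, i, j)) ^ 2 = (2⁻¹ : ℝ) •
        (MvPolynomial.C (c a i) * linForm (s j) - MvPolynomial.C (c a j) * linForm (s i)) ^ 2 := by
      intro i j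
      simp only [y, linForm_smul, hlin, smul_pow, inv_pow, Real.sq_sqrt zero_le_two]
      simp only [MvPolynomial.smul_eq_C_mul]
    simp only [h2, ← Finset.smul_sum]
    rw [h1, hcs]
    have h3 : (MvPolynomial.C (2⁻¹ : ℝ) : MvPolynomial (Fin d) ℝ) * 2 = 1 := by
      rw [← map_ofNat MvPolynomial.C 2, ← map_mul]; norm_num
    simp only [MvPolynomial.smul_eq_C_mul, map_sum, map_pow, mul_sub, ← mul_assoc, h3, one_mul]
    ring
  have h := map_sum_sq_le_add hE Finset.univ Finset.univ (fun a => ∑ i, c a i • s i) y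
  rwa [hsum, smul_pow, map_smul, smul_eq_mul] at h

end Restrict

/-! ### Homogenization -/

section Homogenize

variable {d : ℕ}

/-- The linear map that multiplies the homogeneous parts of degree `4`, `2`, `0` by `1`, `‖v‖²`,
`‖v‖⁴` and kills all others. It changes a functional on quartic forms into one that respects the
sphere constraint. -/
noncomputable def homogenize (d : ℕ) : MvPolynomial (Fin d) ℝ →ₗ[ℝ] MvPolynomial (Fin d) ℝ :=
  MvPolynomial.homogeneousComponent 4
    + LinearMap.mulLeft ℝ (normSqPoly d) ∘ₗ MvPolynomial.homogeneousComponent 2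
    + LinearMap.mulLeft ℝ (normSqPoly d ^ 2) ∘ₗ MvPolynomial.homogeneousComponent 0

theorem homogenize_apply (p : MvPolynomial (Fin d) ℝ) :
    homogenize d p = MvPolynomial.homogeneousComponent 4 p
      + normSqPoly d * MvPolynomial.homogeneousComponent 2 p
      + normSqPoly d ^ 2 * MvPolynomial.homogeneousComponent 0 p := rfl

theorem homogenize_four {p : MvPolynomial (Fin d) ℝ} (hp : p.IsHomogeneous 4) :
    homogenize d p = p := by
  simp [homogenize_apply, MvPolynomial.homogeneousComponent_of_mem hp]

theorem homogenize_two {p : MvPolynomial (Fin d) ℝ} (hp : p.IsHomogeneous 2) :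
    homogenize d p = normSqPoly d * p := by
  simp [homogenize_apply, MvPolynomial.homogeneousComponent_of_mem hp]

theorem homogenize_zero {p : MvPolynomial (Fin d) ℝ} (hp : p.IsHomogeneous 0) :
    homogenize d p = normSqPoly d ^ 2 * p := by
  simp [homogenize_apply, MvPolynomial.homogeneousComponent_of_mem hp]

theorem homogenize_eq_zero {p : MvPolynomial (Fin d) ℝ} {k : ℕ} (hp : p.IsHomogeneous k)
    (h4 : k ≠ 4) (h2 : k ≠ 2) (h0 : k ≠ 0) : homogenize d p = 0 := by
  simp only [homogenize_apply, MvPolynomial.homogeneousComponent_of_mem hp, if_neg h4.symm,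
    if_neg h2.symm, if_neg h0.symm, mul_zero, add_zero]

/-- A nonzero functional on quartic forms that is nonnegative on squares becomes a
pseudoexpectation by homogenization and normalization. -/
theorem isPseudoexpectation_homogenize {F : MvPolynomial (Fin d) ℝ →ₗ[ℝ] ℝ} (hF : SqNonneg F)
    (hZ : 0 < F (normSqPoly d ^ 2)) :
    IsPseudoexpectation d 2 ((F (normSqPoly d ^ 2))⁻¹ • F ∘ₗ homogenize d) where
  map_one := by
    simp [homogenize_zero (MvPolynomial.isHomogeneous_one (Fin d) ℝ), hZ.ne']
  map_sq_nonneg p hp := by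
    obtain ⟨p₀, p₁, p₂, h0, h1, h2, rfl⟩ := exists_homogeneous_decomp hp
    have e : (p₀ + p₁ + p₂) ^ 2
        = p₀ * p₀ + (p₀ * p₁ + p₀ * p₁) + (p₀ * p₂ + p₀ * p₂ + p₁ * p₁)
          + (p₁ * p₂ + p₁ * p₂) + p₂ * p₂ := by ring
    have key : homogenize d ((p₀ + p₁ + p₂) ^ 2)
        = (p₂ + normSqPoly d * p₀) ^ 2 + ∑ j, (MvPolynomial.X j * p₁) ^ 2 := by
      rw [e, map_add, map_add, map_add, map_add, homogenize_zero (h0.mul h0),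
        homogenize_eq_zero ((h0.mul h1).add (h0.mul h1)) (by norm_num) (by norm_num) (by norm_num),
        homogenize_two (((h0.mul h2).add (h0.mul h2)).add (h1.mul h1)),
        homogenize_eq_zero ((h1.mul h2).add (h1.mul h2)) (by norm_num) (by norm_num) (by norm_num),
        homogenize_four (h2.mul h2)]
      simp only [mul_pow, ← Finset.sum_mul]
      rw [← normSqPoly]; ring
    rw [LinearMap.smul_apply, LinearMap.comp_apply, key, map_add, map_sum]
    refine mul_nonneg (inv_nonneg.2 hZ.le) (add_nonneg (hF _ ?_) (Finset.sum_nonneg fun j _ =>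
      hF _ ((MvPolynomial.isHomogeneous_X ℝ j).mul h1).totalDegree_le))
    have := normSqPoly_isHomogeneous.mul h0 (φ := normSqPoly d)
    exact (h2.add this).totalDegree_le
  map_sphere p hp := by
    obtain ⟨p₀, p₁, p₂, h0, h1, h2, rfl⟩ := exists_homogeneous_decomp hp
    have hN : (normSqPoly d).IsHomogeneous 2 := normSqPoly_isHomogeneous
    have e : ((∑ j, MvPolynomial.X j ^ 2) - 1) * (p₀ + p₁ + p₂)
        = normSqPoly d * p₂ + normSqPoly d * p₁ + (normSqPoly d * p₀ - p₂) - p₁ - p₀ := by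
      rw [← normSqPoly]; ring
    have h20 : (normSqPoly d * p₀ - p₂).IsHomogeneous 2 := (hN.mul h0).sub h2
    have key : homogenize d (((∑ j, MvPolynomial.X j ^ 2) - 1) * (p₀ + p₁ + p₂)) = 0 := by
      rw [e, map_sub, map_sub, map_add, map_add, homogenize_four (hN.mul h2),
        homogenize_eq_zero (hN.mul h1) (by norm_num) (by norm_num) (by norm_num),
        homogenize_two h20,
        homogenize_eq_zero h1 (by norm_num) (by norm_num) (by norm_num), homogenize_zero h0]
      ring
    rw [LinearMap.smul_apply, LinearMap.comp_apply, key, map_zero, smul_zero]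

end Homogenize

/-! ### The supremum in `F̃₁` is attained -/

section Attained

variable {n d : ℕ}

open MvPolynomial in
theorem map_X_mul_sq_le {E : MvPolynomial (Fin d) ℝ →ₗ[ℝ] ℝ} (hE : IsPseudoexpectation d 2 E)
    (a : Fin d) {m : MvPolynomial (Fin d) ℝ} (hm : m.IsHomogeneous 0 ∨ m.IsHomogeneous 1) :
    E ((X a * m) ^ 2) ≤ E (m ^ 2) := by
  have hdeg : ∀ b, (X b * m).totalDegree ≤ 2 := by
    intro b
    rcases hm with hm | hm
    · exact ((isHomogeneous_X ℝ b).mul hm).totalDegree_le.trans (by norm_num)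
    · exact ((isHomogeneous_X ℝ b).mul hm).totalDegree_le
  have hdeg2 : (m ^ 2).totalDegree ≤ 2 := by
    rcases hm with hm | hm
    · exact (hm.pow 2).totalDegree_le.trans (by norm_num)
    · exact (hm.pow 2).totalDegree_le
  have h1 := hE.map_sphere (m ^ 2) hdeg2
  have h2 : ((∑ j, X j ^ 2) - 1) * m ^ 2 = ∑ j, (X j * m) ^ 2 - m ^ 2 := by
    simp only [mul_pow, ← Finset.sum_mul]; ring
  rw [h2, map_sub, map_sum] at h1
  have h3 := Finset.single_le_sum (f := fun j => E ((X j * m) ^ 2))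
    (fun j _ => hE.map_sq_nonneg _ (hdeg j)) (Finset.mem_univ a)
  linarith

theorem exists_eq_single_add {s : Fin d →₀ ℕ} {k : ℕ} (hs : s.degree = k + 1) :
    ∃ a t, s = Finsupp.single a 1 + t ∧ t.degree = k := by
  have h0 : s ≠ 0 := by
    rintro rfl; simp at hs
  obtain ⟨a, ha⟩ := Finsupp.ne_iff.1 h0
  refine ⟨a, s - Finsupp.single a 1, ?_, ?_⟩
  · rw [add_tsub_cancel_of_le]
    exact Finsupp.single_le_iff.2 (Nat.one_le_iff_ne_zero.2 ha)
  · have h1 : Finsupp.single a 1 + (s - Finsupp.single a 1) = s :=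
      add_tsub_cancel_of_le (Finsupp.single_le_iff.2 (Nat.one_le_iff_ne_zero.2 ha))
    have h2 := congrArg Finsupp.degree h1
    rw [map_add, Finsupp.degree_single, hs] at h2
    omega

open MvPolynomial in
theorem map_monomial_sq_le_one {E : MvPolynomial (Fin d) ℝ →ₗ[ℝ] ℝ}
    (hE : IsPseudoexpectation d 2 E) {s : Fin d →₀ ℕ} (hs : s.degree ≤ 2) :
    E (monomial s 1 ^ 2) ≤ 1 := by
  have hsplit : ∀ a (t : Fin d →₀ ℕ), (monomial (Finsupp.single a 1 + t) (1 : ℝ))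
      = X a * monomial t 1 := by
    intro a t; rw [X, monomial_mul, one_mul]
  have h0 : ∀ t : Fin d →₀ ℕ, t.degree = 0 → E (monomial t 1 ^ 2) ≤ 1 := by
    intro t ht
    rw [(Finsupp.degree_eq_zero_iff t).1 ht]
    simp [hE.map_one]
  have h1 : ∀ t : Fin d →₀ ℕ, t.degree = 1 → E (monomial t 1 ^ 2) ≤ 1 := by
    intro t ht
    obtain ⟨a, u, rfl, hu⟩ := exists_eq_single_add ht
    rw [hsplit]
    exact (map_X_mul_sq_le hE a (Or.inl (isHomogeneous_monomial 1 hu))).trans (h0 u hu)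
  interval_cases h : s.degree
  · exact h0 s h
  · exact h1 s h
  · obtain ⟨a, u, rfl, hu⟩ := exists_eq_single_add h
    rw [hsplit]
    exact (map_X_mul_sq_le hE a (Or.inr (isHomogeneous_monomial 1 hu))).trans (h1 u hu)

open MvPolynomial in
/-- The pseudo-moments of degree at most `4` are bounded by `1`. -/
theorem abs_map_monomial_le_one {E : MvPolynomial (Fin d) ℝ →ₗ[ℝ] ℝ}
    (hE : IsPseudoexpectation d 2 E) {s : Fin d →₀ ℕ} (hs : s.degree ≤ 4) :
    |E (monomial s 1)| ≤ 1 := by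
  obtain ⟨t, u, rfl, ht, hu⟩ : ∃ t u : Fin d →₀ ℕ, s = t + u ∧ t.degree ≤ 2 ∧ u.degree ≤ 2 := by
    by_cases h2 : s.degree ≤ 2
    · exact ⟨s, 0, by simp, h2, by simp⟩
    obtain ⟨a, t, rfl, ht⟩ := exists_eq_single_add
      (show s.degree = (s.degree - 1) + 1 by omega)
    obtain ⟨b, u, rfl, hu⟩ := exists_eq_single_add
      (show t.degree = (t.degree - 1) + 1 by
        rw [map_add, Finsupp.degree_single] at h2; omega)
    refine ⟨Finsupp.single a 1 + Finsupp.single b 1, u, by rw [add_assoc], ?_, ?_⟩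
    · simp [Finsupp.degree_single]
    · simp only [map_add, Finsupp.degree_single] at hs; omega
  have hdeg : ∀ t : Fin d →₀ ℕ, t.degree ≤ 2 → (monomial t (1 : ℝ)).totalDegree ≤ 2 :=
    fun t ht => (isHomogeneous_monomial 1 rfl).totalDegree_le.trans ht
  have h := abs_map_mul_le_half_add hE.map_sq_nonneg (hdeg t ht) (hdeg u hu)
  rw [monomial_mul, one_mul] at h
  linarith [map_monomial_sq_le_one hE ht, map_monomial_sq_le_one hE hu]

/-- The linear functional with prescribed values on the monomials. -/
noncomputable def ofMoments (f : (Fin d →₀ ℕ) → ℝ) : MvPolynomial (Fin d) ℝ →ₗ[ℝ] ℝ :=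
  (MvPolynomial.basisMonomials (Fin d) ℝ).constr ℝ f

theorem ofMoments_monomial (f : (Fin d →₀ ℕ) → ℝ) (s : Fin d →₀ ℕ) :
    ofMoments f (MvPolynomial.monomial s 1) = f s := by
  have := (MvPolynomial.basisMonomials (Fin d) ℝ).constr_basis ℝ f s
  simpa [ofMoments] using this

theorem ofMoments_map (E : MvPolynomial (Fin d) ℝ →ₗ[ℝ] ℝ) :
    ofMoments (fun s => E (MvPolynomial.monomial s 1)) = E := by
  refine (MvPolynomial.basisMonomials (Fin d) ℝ).ext fun s => ?_
  rw [MvPolynomial.coe_basisMonomials, ofMoments_monomial]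

theorem continuous_ofMoments (p : MvPolynomial (Fin d) ℝ) :
    Continuous fun f : (Fin d →₀ ℕ) → ℝ => ofMoments f p := by
  simp only [ofMoments, Module.Basis.constr_apply, Finsupp.sum, smul_eq_mul]
  fun_prop

/-- The moment sequences of the pseudoexpectations that vanish beyond degree `4` and give the
polynomial `P` at least the value `c`. -/
def momentSet (P : MvPolynomial (Fin d) ℝ) (c : ℝ) : Set ((Fin d →₀ ℕ) → ℝ) :=
  {f | IsPseudoexpectation d 2 (ofMoments f) ∧ (∀ s, 4 < s.degree → f s = 0) ∧
    c ≤ ofMoments f P}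

theorem isCompact_momentSet (P : MvPolynomial (Fin d) ℝ) (c : ℝ) :
    IsCompact (momentSet P c) := by
  refine (isCompact_univ_pi (s := fun _ : Fin d →₀ ℕ => Set.Icc (-1 : ℝ) 1)
    fun _ => isCompact_Icc).of_isClosed_subset ?_ ?_
  · have : momentSet P c = {f | ofMoments f 1 = 1}
        ∩ (⋂ p : MvPolynomial (Fin d) ℝ, ⋂ _ : p.totalDegree ≤ 2, {f | 0 ≤ ofMoments f (p ^ 2)})
        ∩ (⋂ p : MvPolynomial (Fin d) ℝ, ⋂ _ : p.totalDegree ≤ 2,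
            {f | ofMoments f (((∑ j, MvPolynomial.X j ^ 2) - 1) * p) = 0})
        ∩ (⋂ s : Fin d →₀ ℕ, ⋂ _ : 4 < s.degree, {f | f s = 0})
        ∩ {f | c ≤ ofMoments f P} := by
      ext f
      simp only [momentSet, Set.mem_ofPred_eq, Set.mem_inter_iff, Set.mem_iInter]
      constructor
      · rintro ⟨h, h4, hc⟩
        exact ⟨⟨⟨⟨h.map_one, h.map_sq_nonneg⟩, h.map_sphere⟩, h4⟩, hc⟩
      · rintro ⟨⟨⟨⟨h1, h2⟩, h3⟩, h4⟩, hc⟩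
        exact ⟨⟨h1, h2, h3⟩, h4, hc⟩
    rw [this]
    refine IsClosed.inter (IsClosed.inter (IsClosed.inter (IsClosed.inter ?_ ?_) ?_) ?_) ?_
    · exact isClosed_eq (continuous_ofMoments _) continuous_const
    · exact isClosed_iInter fun p => isClosed_iInter fun _ =>
        isClosed_le continuous_const (continuous_ofMoments _)
    · exact isClosed_iInter fun p => isClosed_iInter fun _ =>
        isClosed_eq (continuous_ofMoments _) continuous_const
    · exact isClosed_iInter fun s => isClosed_iInter fun _ =>
        isClosed_eq (continuous_apply s) continuous_const
    · exact isClosed_le continuous_const (continuous_ofMoments _)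
  · rintro f ⟨hf, h4, -⟩ s -
    refine abs_le.1 ?_
    rcases le_or_gt s.degree 4 with hs | hs
    · rw [← ofMoments_monomial f s]
      exact abs_map_monomial_le_one hf hs
    · rw [h4 s hs]; simp

/-- A quotient in the definition of `F̃₁(q)` is also attained by a pseudoexpectation whose
denominator is bounded below independently of the pseudoexpectation. -/
theorem exists_map_momentPoly_ge (X : Covariates n d) {q : Fin n → ℝ} (hq : ∀ i, 0 ≤ q i) :
    ∃ c : ℝ, 0 < c ∧ ∀ E : MvPolynomial (Fin d) ℝ →ₗ[ℝ] ℝ, SqNonneg E →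
      0 < E (momentPoly X q 2 ^ 2) → ∃ E' : MvPolynomial (Fin d) ℝ →ₗ[ℝ] ℝ,
        IsPseudoexpectation d 2 E' ∧ c ≤ E' (momentPoly X q 2 ^ 2) ∧
        (∀ s : Fin d →₀ ℕ, 4 < s.degree → E' (MvPolynomial.monomial s 1) = 0) ∧
        E' (momentPoly X q 4) / E' (momentPoly X q 2 ^ 2)
          = E (momentPoly X q 4) / E (momentPoly X q 2 ^ 2) := by
  obtain ⟨α, hα⟩ := exists_section X q
  set β : Fin d → EuclideanSpace ℝ (Fin d) := fun a => ∑ i, (α i a * √(q i)) • X i with hβ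
  set K : ℝ := (∑ a, ∑ i, α i a ^ 2) ^ 2 with hK
  have hfix : ∀ m, substForm β (momentPoly X q m) = momentPoly X q m := by
    intro m
    simp only [momentPoly, map_sum, map_mul, map_pow, substForm_linForm]
    refine Finset.sum_congr rfl fun i _ => ?_
    rcases (hq i).eq_or_lt with h | h
    · simp [← h]
    · rw [hα i h, ← MvPolynomial.algebraMap_eq, AlgHom.commutes]
  refine ⟨(K + 1)⁻¹, by positivity, fun E hE hD => ?_⟩
  set F := E ∘ₗ (substForm β).toLinearMap with hFdef
  have hF : SqNonneg F := sqNonneg_comp_substForm hE β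
  have hF2 : F (momentPoly X q 2 ^ 2) = E (momentPoly X q 2 ^ 2) := by
    simp [hFdef, hfix]
  have hF4 : F (momentPoly X q 4) = E (momentPoly X q 4) := by
    simp [hFdef, hfix]
  -- `‖v‖²` becomes a combination of the forms `vᵀX_i` after the substitution, and conversely each
  -- of these forms is bounded by `‖v‖²`; so `F(‖v‖⁴)` and the denominator are comparable.
  have hsub : substForm β (normSqPoly d) = ∑ a, linForm (β a) ^ 2 := by
    simp [substForm, normSqPoly]
  have hZle : F (normSqPoly d ^ 2) ≤ K * E (momentPoly X q 2 ^ 2) := by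
    have h := map_sum_linForm_sq_le hE (fun i => √(q i) • X i) (fun a i => α i a)
    simp only [smul_smul] at h
    rw [← momentPoly_two_eq_sum X hq] at h
    simpa only [hFdef, LinearMap.comp_apply, AlgHom.toLinearMap_apply, map_pow, hsub] using h
  have hZ0 : 0 < F (normSqPoly d ^ 2) := by
    have h := map_sum_linForm_sq_le hF (fun a => EuclideanSpace.single a (1 : ℝ))
      (fun (i : Fin n) a => √(q i) * X i a)
    have hx : ∀ i, ∑ a, (√(q i) * X i a) • EuclideanSpace.single a (1 : ℝ) = √(q i) • X i := by
      intro i; ext j; simp [Finset.sum_apply, Pi.single_apply]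
    simp only [hx] at h
    rw [← momentPoly_two_eq_sum X hq, ← normSqPoly_eq_sum, hF2] at h
    exact pos_of_mul_pos_right (hD.trans_le h) (sq_nonneg _)
  set Z := F (normSqPoly d ^ 2) with hZ
  have hE2 : (Z⁻¹ • F ∘ₗ homogenize d) (momentPoly X q 2 ^ 2) = Z⁻¹ * E (momentPoly X q 2 ^ 2) := by
    rw [LinearMap.smul_apply, LinearMap.comp_apply,
      homogenize_four ((momentPoly_isHomogeneous X q 2).pow 2), hF2, smul_eq_mul]
  have hE4 : (Z⁻¹ • F ∘ₗ homogenize d) (momentPoly X q 4) = Z⁻¹ * E (momentPoly X q 4) := by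
    rw [LinearMap.smul_apply, LinearMap.comp_apply,
      homogenize_four (momentPoly_isHomogeneous X q 4), hF4, smul_eq_mul]
  refine ⟨Z⁻¹ • F ∘ₗ homogenize d, isPseudoexpectation_homogenize hF hZ0, ?_, fun s hs => ?_, ?_⟩
  · rw [hE2, inv_mul_eq_div, le_div_iff₀ hZ0, inv_mul_le_iff₀ (by positivity)]
    linarith
  · have h0 : homogenize d (MvPolynomial.monomial s 1) = 0 :=
      homogenize_eq_zero (MvPolynomial.isHomogeneous_monomial 1 rfl) (by omega) (by omega)
        (by omega)
    rw [LinearMap.smul_apply, LinearMap.comp_apply, h0, map_zero, smul_zero]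
  · rw [hE2, hE4, mul_div_mul_left _ _ (inv_ne_zero hZ0.ne')]

/-- If some pseudoexpectation has a positive denominator, the supremum in `F̃₁` is a maximum. -/
theorem exists_certHyper_eq (X : Covariates n d) {q : Fin n → ℝ} (hq : ∀ i, 0 ≤ q i)
    (h : ∃ E, IsPseudoexpectation d 2 E ∧ 0 < E (momentPoly X q 2 ^ 2)) :
    ∃ E, IsPseudoexpectation d 2 E ∧ 0 < E (momentPoly X q 2 ^ 2) ∧
      certHyper X q ≤ ((E (momentPoly X q 4) / E (momentPoly X q 2 ^ 2) : ℝ) : EReal) := by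
  obtain ⟨c, hc, hex⟩ := exists_map_momentPoly_ge X hq
  have key : ∀ E : MvPolynomial (Fin d) ℝ →ₗ[ℝ] ℝ, IsPseudoexpectation d 2 E →
      0 < E (momentPoly X q 2 ^ 2) → ∃ f ∈ momentSet (momentPoly X q 2 ^ 2) c,
        ofMoments f (momentPoly X q 4) / ofMoments f (momentPoly X q 2 ^ 2)
          = E (momentPoly X q 4) / E (momentPoly X q 2 ^ 2) := by
    intro E hE hD
    obtain ⟨E', h1, h2, h3, h4⟩ := hex E hE.map_sq_nonneg hD
    refine ⟨fun s => E' (MvPolynomial.monomial s 1), ⟨?_, h3, ?_⟩, ?_⟩ <;> rwa [ofMoments_map]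
  obtain ⟨E₀, hE₀, hD₀⟩ := h
  obtain ⟨f₀, hf₀, -⟩ := key E₀ hE₀ hD₀
  obtain ⟨f, hf, hmax⟩ := (isCompact_momentSet (momentPoly X q 2 ^ 2) c).exists_isMaxOn ⟨f₀, hf₀⟩
    (f := fun f => ofMoments f (momentPoly X q 4) / ofMoments f (momentPoly X q 2 ^ 2))
    ((continuous_ofMoments _).continuousOn.div (continuous_ofMoments _).continuousOn
      fun f hf => (hc.trans_le hf.2.2).ne')
  refine ⟨ofMoments f, hf.1, hc.trans_le hf.2.2, ?_⟩
  unfold certHyper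
  refine iSup_le fun E => iSup_le fun hE => iSup_le fun hD => ?_
  obtain ⟨g, hg, hgE⟩ := key E hE hD
  rw [← hgE]
  exact EReal.coe_le_coe_iff.2 (hmax hg)

theorem exists_admissible₁ (X : Covariates n d) {q : Fin n → ℝ} (hq : ∀ i, 0 ≤ q i) {κ' : ℝ}
    (h : ((κ' ^ 2 : ℝ) : EReal) ≤ certHyper X q) : ∃ E, Admissible₁ X κ' q E := by
  have hne : ∃ E, IsPseudoexpectation d 2 E ∧ 0 < E (momentPoly X q 2 ^ 2) := by
    by_contra hcon
    push Not at hcon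
    have : certHyper X q = ⊥ := by
      unfold certHyper
      simp only [iSup_eq_bot]
      exact fun E hE hD => absurd hD (not_lt.2 (hcon E hE))
    rw [this] at h
    exact EReal.coe_ne_bot _ (le_bot_iff.1 h)
  obtain ⟨E, hE, hD, hsup⟩ := exists_certHyper_eq X hq hne
  exact ⟨E, hE, hD, (le_div_iff₀ hD).1 (EReal.coe_le_coe_iff.1 (h.trans hsup))⟩

end Attained

/-! ### The supremum in `F₂` is attained -/

section NoiseAttained

variable {n d : ℕ}

theorem secondMoment_nonneg (X : Covariates n d) {q : Fin n → ℝ} (hq : ∀ i, 0 ≤ q i)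
    (v : EuclideanSpace ℝ (Fin d)) : 0 ≤ secondMoment X q v := by
  unfold secondMoment expect
  exact Finset.sum_nonneg fun i _ => mul_nonneg (hq i) (sq_nonneg _)

theorem noiseMoment_nonneg (X : Covariates n d) (Y : Fin n → ℝ) {q : Fin n → ℝ}
    (hq : ∀ i, 0 ≤ q i) (v : EuclideanSpace ℝ (Fin d)) : 0 ≤ noiseMoment X Y q v := by
  unfold noiseMoment expect
  exact Finset.sum_nonneg fun i _ => mul_nonneg (hq i) (by positivity)

/-- Quotients of two weighted sums of squares of the same linear forms attain their supremum: they
only depend on the direction of the vector of these forms, which ranges over a compact set. -/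
theorem exists_noise_quotient_max (X : Covariates n d) (Y : Fin n → ℝ) {q : Fin n → ℝ}
    (hq : ∀ i, 0 ≤ q i) (h : ∃ v, 0 < secondMoment X q v) :
    ∃ v, 0 < secondMoment X q v ∧ ∀ w, 0 < secondMoment X q w →
      noiseMoment X Y q w / secondMoment X q w ≤ noiseMoment X Y q v / secondMoment X q v := by
  let T : EuclideanSpace ℝ (Fin d) →ₗ[ℝ] EuclideanSpace ℝ (Fin n) :=
    { toFun := fun v => WithLp.toLp 2 (fun i => √(q i) * inner ℝ v (X i))
      map_add' := fun a b => by ext i; simp [inner_add_left, mul_add]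
      map_smul' := fun c a => by ext i; simp [inner_smul_left]; ring }
  have hTi : ∀ v i, T v i ^ 2 = q i * inner ℝ v (X i) ^ 2 := by
    intro v i
    simp only [T, LinearMap.coe_mk, AddHom.coe_mk, mul_pow, Real.sq_sqrt (hq i)]
  have hD : ∀ v, secondMoment X q v = ‖T v‖ ^ 2 := by
    intro v
    rw [EuclideanSpace.real_norm_sq_eq, secondMoment, expect]
    exact Finset.sum_congr rfl fun i _ => (hTi v i).symm
  let N : EuclideanSpace ℝ (Fin n) → ℝ := fun u =>
    ∑ i, resid X Y (theta X Y q) i ^ 2 * u i ^ 2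
  have hN : ∀ v, noiseMoment X Y q v = N (T v) := by
    intro v
    rw [noiseMoment, expect]
    refine Finset.sum_congr rfl fun i _ => ?_
    rw [hTi]; ring
  have hNc : Continuous N := by
    refine continuous_finsetSum _ fun i _ => ?_
    exact continuous_const.mul ((EuclideanSpace.proj (𝕜 := ℝ) i).continuous.pow 2)
  have hNs : ∀ (c : ℝ) u, N (c • u) = c ^ 2 * N u := by
    intro c u
    simp only [N, Finset.mul_sum]
    refine Finset.sum_congr rfl fun i _ => ?_
    simp; ring
  have hcomp : IsCompact ((LinearMap.range T : Set (EuclideanSpace ℝ (Fin n))) ∩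
      Metric.sphere 0 1) :=
    (isCompact_sphere 0 1).inter_left (Submodule.closed_of_finiteDimensional _)
  have hunit : ∀ w, 0 < secondMoment X q w → ‖T w‖⁻¹ • T w ∈
      (LinearMap.range T : Set (EuclideanSpace ℝ (Fin n))) ∩ Metric.sphere 0 1 := by
    intro w hw
    have hpos : ‖T w‖ ≠ 0 := by
      intro h0; rw [hD, h0] at hw; norm_num at hw
    refine ⟨⟨‖T w‖⁻¹ • w, map_smul _ _ _⟩, ?_⟩
    rw [mem_sphere_zero_iff_norm, norm_smul, norm_inv, norm_norm, inv_mul_cancel₀ hpos]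
  obtain ⟨v₀, hv₀⟩ := h
  obtain ⟨u, ⟨⟨v, rfl⟩, hu⟩, hmax⟩ := hcomp.exists_isMaxOn ⟨_, hunit v₀ hv₀⟩ hNc.continuousOn
  rw [mem_sphere_zero_iff_norm] at hu
  refine ⟨v, by rw [hD, hu]; norm_num, fun w hw => ?_⟩
  have h1 : N (‖T w‖⁻¹ • T w) ≤ N (T v) := hmax (hunit w hw)
  rw [hNs, inv_pow, inv_mul_eq_div] at h1
  rw [hN, hD, hN, hD, hu]
  simpa using h1

theorem exists_admissible₂ (X : Covariates n d) (Y : Fin n → ℝ) {q : Fin n → ℝ}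
    (hq : ∀ i, 0 ≤ q i) {σ' : ℝ} (h : ((σ' ^ 2 : ℝ) : EReal) ≤ boundedNoise X Y q) :
    ∃ v, Admissible₂ X Y σ' q v := by
  have hne : ∃ v, 0 < secondMoment X q v := by
    by_contra hcon
    push Not at hcon
    have : boundedNoise X Y q = ⊥ := by
      unfold boundedNoise
      simp only [iSup_eq_bot]
      exact fun v hD => absurd hD (not_lt.2 (hcon v))
    rw [this] at h
    exact EReal.coe_ne_bot _ (le_bot_iff.1 h)
  obtain ⟨v, hv, hmax⟩ := exists_noise_quotient_max X Y hq hne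
  refine ⟨v, hv, ?_, fun w hw => ?_⟩
  · have : boundedNoise X Y q ≤ ((noiseMoment X Y q v / secondMoment X q v : ℝ) : EReal) := by
      unfold boundedNoise
      exact iSup_le fun w => iSup_le fun hw => EReal.coe_le_coe_iff.2 (hmax w hw)
    exact (le_div_iff₀ hv).1 (EReal.coe_le_coe_iff.1 (h.trans this))
  · have h0 : 0 ≤ noiseMoment X Y q w / secondMoment X q w :=
      div_nonneg (noiseMoment_nonneg X Y hq w) hw.le
    linarith [hmax w hw]

end NoiseAttained

/-! ### Weights of the filter -/

section Filter

variable {n : ℕ}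

/-- `w` is obtained by downweighting all points, removing at most as much mass from the good
points `S` as from the others. -/
structure IsFilterWeight (S : Finset (Fin n)) (w : Fin n → ℝ) : Prop where
  nonneg : ∀ i, 0 ≤ w i
  le_one : ∀ i, w i ≤ 1
  removed_le : ∑ i ∈ S, (1 - w i) ≤ ∑ i ∈ Sᶜ, (1 - w i)

/-- The distribution proportional to `w`. -/
noncomputable def normalized (w : Fin n → ℝ) : Fin n → ℝ := fun i => w i / ∑ j, w j

namespace IsFilterWeight

variable {S : Finset (Fin n)} {w : Fin n → ℝ}

theorem removed_compl_le (hw : IsFilterWeight S w) : ∑ i ∈ Sᶜ, (1 - w i) ≤ (Sᶜ.card : ℝ) := by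
  rw [Finset.card_eq_sum_ones, Nat.cast_sum]
  exact Finset.sum_le_sum fun i _ => by simpa using hw.nonneg i

theorem removed_nonneg (hw : IsFilterWeight S w) : 0 ≤ ∑ i ∈ S, (1 - w i) :=
  Finset.sum_nonneg fun i _ => sub_nonneg.2 (hw.le_one i)

theorem sum_eq (S : Finset (Fin n)) (w : Fin n → ℝ) :
    ∑ i, w i = n - ∑ i ∈ S, (1 - w i) - ∑ i ∈ Sᶜ, (1 - w i) := by
  have h := Finset.sum_add_sum_compl S fun i => 1 - w i
  rw [Finset.sum_sub_distrib (s := Finset.univ)] at h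
  simp only [Finset.sum_const, Finset.card_univ, Fintype.card_fin, nsmul_eq_mul, mul_one] at h
  linarith

/-- The number of points without mass is at most twice the number of outliers. -/
theorem card_zero_le (hw : IsFilterWeight S w) :
    ((Finset.univ.filter fun i => w i = 0).card : ℝ) ≤ 2 * (Sᶜ.card : ℝ) := by
  have h1 : ((Finset.univ.filter fun i => w i = 0).card : ℝ) ≤ ∑ i, (1 - w i) := by
    rw [Finset.card_filter, Nat.cast_sum]
    refine Finset.sum_le_sum fun i _ => ?_
    split_ifs with h
    · simp [h]
    · simpa using hw.le_one i
  have h2 := Finset.sum_add_sum_compl S fun i => 1 - w i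
  linarith [hw.removed_le, hw.removed_compl_le]

/-- Downweighting by `1 - g_i / g_max` keeps the invariant when the good points carry at most half
of `𝔼_q[g]`, and it removes all the mass of at least one more point. -/
theorem update_normalized (hw : IsFilterWeight S w) (hpos : 0 < ∑ i, w i) {g : Fin n → ℝ}
    (hg : ∀ i, 0 ≤ g i) (hgpos : 0 < expect (normalized w) g)
    (hgS : 2 * ∑ i ∈ S, normalized w i * g i ≤ expect (normalized w) g) :
    ∃ w', IsFilterWeight S w' ∧ update (normalized w) g = normalized w' ∧
      (Finset.univ.filter fun i => w i = 0).card < (Finset.univ.filter fun i => w' i = 0).card := by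
  have hqpos : ∀ i, 0 < normalized w i ↔ 0 < w i := fun i => by
    rw [normalized, div_pos_iff_of_pos_right hpos]
  have hq0 : ∀ i, 0 ≤ normalized w i := fun i => div_nonneg (hw.nonneg i) hpos.le
  set G := gmax (normalized w) g with hG
  have hbdd : BddAbove (Set.range fun i : {i : Fin n // 0 < normalized w i} => g i) :=
    (Set.finite_range _).bddAbove
  have hle : ∀ i, 0 < w i → g i ≤ G := fun i hi =>
    le_ciSup hbdd (⟨i, (hqpos i).2 hi⟩ : {i : Fin n // 0 < normalized w i})
  obtain ⟨i₁, -, hi₁⟩ := Finset.exists_lt_of_sum_lt (s := Finset.univ) (f := fun _ => (0 : ℝ))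
    (g := fun i => normalized w i * g i) (by simpa [expect] using hgpos)
  have hqi₁ : 0 < normalized w i₁ := pos_of_mul_pos_left hi₁ (hg i₁)
  have hgi₁ : 0 < g i₁ := pos_of_mul_pos_right hi₁ (hq0 i₁)
  have hGpos : 0 < G := hgi₁.trans_le (hle i₁ ((hqpos _).1 hqi₁))
  obtain ⟨⟨i₀, hqi₀⟩, hi₀⟩ : ∃ i : {i : Fin n // 0 < normalized w i}, g i = G := by
    have : Nonempty {i : Fin n // 0 < normalized w i} := ⟨⟨i₁, hqi₁⟩⟩
    exact exists_eq_ciSup_of_finite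
  have hi₀w := (hqpos _).1 hqi₀
  have hfac : ∀ i, 0 < w i → 0 ≤ 1 - 1 / G * g i := fun i hi => by
    rw [one_div_mul_eq_div, sub_nonneg, div_le_one hGpos]; exact hle i hi
  set w' : Fin n → ℝ := fun i => w i * (1 - 1 / G * g i) with hw'
  have hw'nn : ∀ i, 0 ≤ w' i := fun i => by
    rcases (hw.nonneg i).eq_or_lt with h | h
    · simp [hw', ← h]
    · exact mul_nonneg h.le (hfac i h)
  have hw'le : ∀ i, w' i ≤ w i := fun i => by
    have : 0 ≤ 1 / G * g i := mul_nonneg (by positivity) (hg i)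
    exact mul_le_of_le_one_right (hw.nonneg i) (by linarith)
  refine ⟨w', ⟨hw'nn, fun i => (hw'le i).trans (hw.le_one i), ?_⟩, ?_, ?_⟩
  · have hsplit : ∀ A : Finset (Fin n), ∑ i ∈ A, (1 - w' i)
        = ∑ i ∈ A, (1 - w i) + (∑ j, w j) / G * ∑ i ∈ A, normalized w i * g i := by
      intro A
      rw [Finset.mul_sum, ← Finset.sum_add_distrib]
      refine Finset.sum_congr rfl fun i _ => ?_
      simp only [hw', normalized]
      field_simp
      ring
    rw [hsplit, hsplit]
    have h1 : expect (normalized w) g = ∑ i ∈ S, normalized w i * g i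
        + ∑ i ∈ Sᶜ, normalized w i * g i := (Finset.sum_add_sum_compl S _).symm
    have h2 : ∑ i ∈ S, normalized w i * g i ≤ ∑ i ∈ Sᶜ, normalized w i * g i := by linarith
    have h3 := mul_le_mul_of_nonneg_left h2 (div_pos hpos hGpos).le
    linarith [hw.removed_le]
  · funext i
    have hd : ∀ j, downweight (normalized w) g j = w' j / ∑ k, w k := by
      intro j
      simp only [downweight, hw', normalized, ← hG]
      ring
    simp only [update, hd, normalized, ← Finset.sum_div]
    rw [div_div_div_cancel_right₀ hpos.ne']
  · refine Finset.card_lt_card (Finset.ssubset_iff_of_subset ?_ |>.2 ⟨i₀, ?_, ?_⟩)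
    · intro i hi
      simp only [Finset.mem_filter, Finset.mem_univ, true_and] at hi ⊢
      simp [hw', hi]
    · simp only [Finset.mem_filter, Finset.mem_univ, true_and, hw']
      simp only at hi₀
      rw [hi₀, one_div_mul_cancel hGpos.ne', sub_self, mul_zero]
    · simp [hi₀w.ne']

end IsFilterWeight

/-- Two weight vectors of the same total differ from their minimum by the same amount. -/
theorem sum_sub_min_comm {p q : Fin n → ℝ} (h : ∑ i, p i = ∑ i, q i) :
    ∑ i, (p i - min (p i) (q i)) = ∑ i, (q i - min (p i) (q i)) := by
  rw [Finset.sum_sub_distrib, Finset.sum_sub_distrib, h]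

theorem tv_le_of_sum_sub_min_le {p q : Fin n → ℝ} {τ : ℝ}
    (hτ : ∑ i, (q i - min (p i) (q i)) ≤ τ) : tv q p ≤ τ := by
  refine ciSup_le fun A => ?_
  rw [← Finset.sum_sub_distrib]
  calc ∑ i ∈ A, (q i - p i) ≤ ∑ i ∈ A, (q i - min (p i) (q i)) :=
        Finset.sum_le_sum fun i _ => by linarith [min_le_left (p i) (q i)]
    _ ≤ ∑ i, (q i - min (p i) (q i)) :=
        Finset.sum_le_sum_of_subset_of_nonneg (Finset.subset_univ _) fun i _ _ =>
          sub_nonneg.2 (min_le_right _ _)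
    _ ≤ τ := hτ

end Filter

/-! ### Overlap of the filtered distribution with the good one -/

section Overlap

variable {n d : ℕ} {S : Finset (Fin n)} {w : Fin n → ℝ} {ε : ℝ}

theorem card_compl_eq (hS : (S.card : ℝ) = (1 - ε) * n) : (Sᶜ.card : ℝ) = ε * n := by
  have h := Finset.card_add_card_compl S
  rw [Fintype.card_fin] at h
  have h' : (S.card : ℝ) + (Sᶜ.card : ℝ) = n := by exact_mod_cast h
  linarith

theorem empirical_nonneg (S : Finset (Fin n)) (i : Fin n) : 0 ≤ empirical S i := by
  unfold empirical; split_ifs <;> positivity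

theorem sum_empirical (hS : 0 < (S.card : ℝ)) : ∑ i, empirical S i = 1 := by
  simp [empirical, Finset.sum_ite_mem, mul_inv_cancel₀ hS.ne']

theorem normalized_nonneg (hw : ∀ i, 0 ≤ w i) (i : Fin n) : 0 ≤ normalized w i :=
  div_nonneg (hw i) (Finset.sum_nonneg fun i _ => hw i)

theorem sum_normalized (hN : 0 < ∑ i, w i) : ∑ i, normalized w i = 1 := by
  simp only [normalized, ← Finset.sum_div, div_self hN.ne']

namespace IsFilterWeight

theorem removed_compl_le_mul (hw : IsFilterWeight S w) (hS : (S.card : ℝ) = (1 - ε) * n) :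
    ∑ i ∈ Sᶜ, (1 - w i) ≤ ε * n := by
  rw [← card_compl_eq hS]; exact hw.removed_compl_le

theorem removed_le_mul (hw : IsFilterWeight S w) (hS : (S.card : ℝ) = (1 - ε) * n) :
    ∑ i ∈ S, (1 - w i) ≤ ε * n :=
  hw.removed_le.trans (hw.removed_compl_le_mul hS)

theorem le_sum (hw : IsFilterWeight S w) (hS : (S.card : ℝ) = (1 - ε) * n) :
    (1 - 2 * ε) * n ≤ ∑ i, w i := by
  rw [sum_eq S]
  linarith [hw.removed_le_mul hS, hw.removed_compl_le_mul hS]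

theorem sum_compl_le (hw : IsFilterWeight S w) (hS : (S.card : ℝ) = (1 - ε) * n) :
    ∑ i ∈ Sᶜ, w i ≤ ε * n := by
  rw [← card_compl_eq hS, Finset.card_eq_sum_ones, Nat.cast_sum]
  exact Finset.sum_le_sum fun i _ => by simpa using hw.le_one i

/-- The mass of the filtered distribution outside the good distribution. -/
theorem sum_sub_min_le (hw : IsFilterWeight S w) (hS : (S.card : ℝ) = (1 - ε) * n)
    (hpos : 0 < (S.card : ℝ)) (hN : 0 < ∑ i, w i) (hε : 0 ≤ ε) :
    ∑ i, (normalized w i - min (empirical S i) (normalized w i)) ≤ ε / (1 - ε) := by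
  have hn : ε * n / S.card = ε / (1 - ε) := by
    rw [hS, mul_div_mul_right]
    rintro h0; rw [hS, h0, mul_zero] at hpos; exact lt_irrefl _ hpos
  have hq := normalized_nonneg hw.nonneg
  rw [← hn]
  rcases le_or_gt (S.card : ℝ) (∑ i, w i) with hc | hc
  -- If more mass is left than `S` has at the start, then `q ≤ p_S` on `S`.
  · calc ∑ i, (normalized w i - min (empirical S i) (normalized w i))
        ≤ ∑ i, if i ∈ Sᶜ then normalized w i else 0 := by
          refine Finset.sum_le_sum fun i _ => ?_
          by_cases hi : i ∈ S
          · have h1 : normalized w i ≤ empirical S i := by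
              simp only [normalized, empirical, hi, if_true]
              exact div_le_div₀ zero_le_one (hw.le_one i) hpos hc
            simp [hi, min_eq_right h1]
          · simp [hi, empirical, hq i]
      _ = (∑ i ∈ Sᶜ, w i) / ∑ i, w i := by
          rw [Finset.sum_ite_mem, Finset.univ_inter, Finset.sum_div]; rfl
      _ ≤ ε * n / S.card :=
          div_le_div₀ (by positivity) (hw.sum_compl_le hS) hpos hc
  -- Otherwise `p_S - q` is at most the removed mass, up to normalization.
  · rw [← sum_sub_min_comm ((sum_empirical hpos).trans (sum_normalized hN).symm)]
    calc ∑ i, (empirical S i - min (empirical S i) (normalized w i))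
        ≤ ∑ i, if i ∈ S then (1 - w i) / S.card else 0 := by
          refine Finset.sum_le_sum fun i _ => ?_
          by_cases hi : i ∈ S
          · have h1 : w i / S.card ≤ normalized w i :=
              div_le_div_of_nonneg_left (hw.nonneg i) hN hc.le
            have h2 : w i / S.card ≤ empirical S i := by
              simp only [empirical, hi, if_true]
              gcongr; exact hw.le_one i
            have h3 : empirical S i = 1 / S.card := by simp [empirical, hi]
            rw [if_pos hi, sub_div]
            linarith [le_min h2 h1]
          · simp [hi, empirical, hq i]
      _ = (∑ i ∈ S, (1 - w i)) / S.card := by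
          rw [Finset.sum_ite_mem, Finset.univ_inter, Finset.sum_div]
      _ ≤ ε * n / S.card := by
          gcongr; exact hw.removed_le_mul hS

end IsFilterWeight

end Overlap

/-! ### The hypercontractivity filter removes mostly outliers -/

section HyperFilter

variable {n d : ℕ} {S : Finset (Fin n)} {w : Fin n → ℝ} {ε : ℝ}

/-- The trade-off behind the hypercontractivity filter: if the total fourth moment `T₁ + T₂` is
at most `K` times the square of a sum of second moments, and the second part of that sum is small
because its total weight `ρ` is small, then the first parts satisfy a bound of the same kind. -/
theorem fourth_moment_tradeoff {K ρ P Q R T₁ T₂ : ℝ} (hK : 0 ≤ K) (hρ : 0 ≤ ρ) (hKρ : K * ρ ≤ 1)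
    (hP : 0 ≤ P) (hR : 0 ≤ R) (hT₂ : 0 ≤ T₂) (hQ : Q ^ 2 ≤ P * R) (hRT : R ≤ ρ * T₂)
    (hT : T₁ + T₂ ≤ K * (P + 2 * Q + R)) : T₁ * (1 - K * ρ) ≤ K * P := by
  rcases hρ.eq_or_lt with rfl | hρ
  · have hR0 : R = 0 := le_antisymm (by linarith) hR
    have hQ0 : Q = 0 := by
      rw [hR0, mul_zero] at hQ
      exact pow_eq_zero_iff two_ne_zero |>.1 (le_antisymm hQ (sq_nonneg _))
    rw [hR0, hQ0] at hT
    linarith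
  set s := K * ρ with hs
  have hs0 : 0 ≤ s := mul_nonneg hK hρ.le
  have amgm : 2 * (s * (1 - s)) * Q ≤ s ^ 2 * P + (1 - s) ^ 2 * R := by
    refine (le_abs_self _).trans (abs_le_of_sq_le_sq ?_ (by positivity))
    have := mul_le_mul_of_nonneg_left hQ (by positivity : 0 ≤ 4 * (s * (1 - s)) ^ 2)
    nlinarith [sq_nonneg (s ^ 2 * P - (1 - s) ^ 2 * R)]
  have h1 : (1 - s) * (ρ * (T₁ + T₂)) ≤ (1 - s) * (ρ * (K * (P + 2 * Q + R))) := by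
    have : 0 ≤ 1 - s := by linarith
    gcongr
  have h2 : (1 - s) * R ≤ (1 - s) * (ρ * T₂) :=
    mul_le_mul_of_nonneg_left hRT (by linarith)
  have h3 : ρ * (T₁ * (1 - s)) ≤ ρ * (K * P) := by
    have e1 : (1 - s) * (ρ * (K * (P + 2 * Q + R))) = (1 - s) * (s * (P + 2 * Q + R)) := by
      rw [hs]; ring
    have e2 : ρ * (K * P) = s * P := by rw [hs]; ring
    rw [e1] at h1
    rw [e2]
    nlinarith
  exact le_of_mul_le_mul_left h3 hρ

/-- The good points carry at most half of `𝔼_q[g₁]`. -/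
theorem two_mul_sum_grad₁_le (X : Covariates n d) (hw : IsFilterWeight S w)
    (hS : (S.card : ℝ) = (1 - ε) * n) (hpos : 0 < (S.card : ℝ)) (hN : 0 < ∑ i, w i)
    {κ κ' : ℝ} (hκ : 1 ≤ κ) (hε : 0 ≤ ε) (hκε : 2 * κ ^ 2 * ε < 1)
    (hκ' : κ' ^ 2 = 2 * κ ^ 2 / (1 - 2 * κ ^ 2 * ε))
    (hyp : certHyper X (empirical S) ≤ ((κ ^ 2 : ℝ) : EReal))
    {E : MvPolynomial (Fin d) ℝ →ₗ[ℝ] ℝ} (hE : Admissible₁ X κ' (normalized w) E) :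
    2 * ∑ i ∈ S, normalized w i * grad₁ X E i ≤ expect (normalized w) (grad₁ X E) := by
  obtain ⟨hE, -, hge⟩ := hE
  have hsq : SqNonneg E := hE.map_sq_nonneg
  set N := ∑ i, w i with hNdef
  set p := empirical S with hp
  have hp0 : ∀ i, 0 ≤ p i := empirical_nonneg S
  have hpS : ∀ i ∈ S, p i = 1 / S.card := fun i hi => by rw [hp, empirical, if_pos hi]
  have hpn : ∀ i ∉ S, p i = 0 := fun i hi => by rw [hp, empirical, if_neg hi]
  set a : Fin n → ℝ := fun i => w i * p i with ha
  set b : Fin n → ℝ := fun i => (1 - w i) * p i with hb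
  have ha0 : ∀ i, 0 ≤ a i := fun i => mul_nonneg (hw.nonneg i) (hp0 i)
  have hb0 : ∀ i, 0 ≤ b i := fun i => mul_nonneg (sub_nonneg.2 (hw.le_one i)) (hp0 i)
  have hab : p = a + b := by funext i; simp only [ha, hb, Pi.add_apply]; ring
  set r := ∑ i ∈ S, (1 - w i) with hr
  have hr0 : 0 ≤ r := hw.removed_nonneg
  have hrε : r ≤ ε * n := hw.removed_le_mul hS
  have hsumb : ∑ i, b i = r / S.card := by
    simp only [hb, hp, empirical, mul_ite, mul_zero, Finset.sum_ite_mem, Finset.univ_inter, hr,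
      Finset.sum_div]
    exact Finset.sum_congr rfl fun i _ => by ring
  have hn0 : (0 : ℝ) ≤ n := n.cast_nonneg
  have hκ2 : 1 ≤ κ ^ 2 := one_le_pow₀ hκ
  have hκr : κ ^ 2 * r ≤ κ ^ 2 * (ε * n) := by gcongr
  have hεn : 0 ≤ ε * n := mul_nonneg hε hn0
  have hkεn : 1 * (ε * n) ≤ κ ^ 2 * (ε * n) := by gcongr
  have hnpos : (0 : ℝ) < n := by
    rcases hn0.eq_or_lt with h | h
    · rw [hS, ← h, mul_zero] at hpos; exact absurd hpos (lt_irrefl _)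
    · exact h
  have hgap : 0 < (1 - 2 * κ ^ 2 * ε) * n := mul_pos (by linarith) hnpos
  -- The comparison of normalizations: `N (1 - 2κ²ε) ≤ |S| - κ² r`.
  have hnorm : N * (1 - 2 * κ ^ 2 * ε) ≤ S.card - κ ^ 2 * r := by
    have hNle : N ≤ n := by
      rw [hNdef, IsFilterWeight.sum_eq S w]
      linarith [hw.removed_le]
    have : N * (1 - 2 * κ ^ 2 * ε) ≤ n * (1 - 2 * κ ^ 2 * ε) := by
      apply mul_le_mul_of_nonneg_right hNle; linarith
    rw [hS]; nlinarith
  have hP0 : 0 ≤ E (momentPoly X a 2 ^ 2) := hsq _ (momentPoly_isHomogeneous X a 2).totalDegree_le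
  have hR0 : 0 ≤ E (momentPoly X b 2 ^ 2) := hsq _ (momentPoly_isHomogeneous X b 2).totalDegree_le
  have hT20 : 0 ≤ E (momentPoly X b 4) := by
    rw [map_momentPoly_four]
    exact Finset.sum_nonneg fun i _ => mul_nonneg (hb0 i) (grad₁_nonneg hsq X i)
  have hT : E (momentPoly X a 4) + E (momentPoly X b 4) ≤ κ ^ 2 * (E (momentPoly X a 2 ^ 2)
      + 2 * E (momentPoly X a 2 * momentPoly X b 2) + E (momentPoly X b 2 ^ 2)) := by
    have h := map_momentPoly_four_le_of_certHyper_le X hp0 hyp hE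
    rw [hab, momentPoly_add, momentPoly_add, add_sq, mul_assoc, two_mul, map_add, map_add, map_add,
      map_add, ← two_mul] at h
    exact h
  have hKρ : κ ^ 2 * (r / S.card) ≤ 1 := by
    rw [← mul_div_assoc, div_le_one hpos]
    have := mul_pos hN (by linarith : 0 < 1 - 2 * κ ^ 2 * ε)
    linarith
  have htrade := fourth_moment_tradeoff (sq_nonneg κ) (div_nonneg hr0 hpos.le) hKρ hP0 hR0 hT20
    (map_mul_sq_le hsq (momentPoly_isHomogeneous X a 2).totalDegree_le
      (momentPoly_isHomogeneous X b 2).totalDegree_le)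
    (hsumb ▸ map_momentPoly_two_sq_le hsq X hb0) hT
  obtain ⟨c, hc⟩ : ∃ c, c = (S.card : ℝ) / N := ⟨_, rfl⟩
  have hc0 : 0 < c := hc ▸ div_pos hpos hN
  have hqa : ∀ i ∈ S, normalized w i = c * a i := by
    intro i hi
    have h1 : a i = w i * (1 / S.card) := by rw [← hpS i hi]
    rw [h1, hc, normalized, ← hNdef, mul_one_div, div_mul_div_comm, mul_comm N,
      mul_div_mul_left _ _ hpos.ne']
  have hqle : ∀ i, (c • a) i ≤ normalized w i := by
    intro i
    by_cases hi : i ∈ S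
    · exact (hqa i hi).ge
    · have h1 : (c • a) i = c * (w i * p i) := rfl
      rw [h1, hpn i hi, mul_zero, mul_zero]
      exact normalized_nonneg hw.nonneg i
  have hq2 : c ^ 2 * E (momentPoly X a 2 ^ 2) ≤ E (momentPoly X (normalized w) 2 ^ 2) := by
    have hca0 : ∀ i, 0 ≤ (c • a) i := fun i => mul_nonneg hc0.le (ha0 i)
    have h := map_momentPoly_two_mul_le hsq X hca0 hca0 hqle hqle
    rw [momentPoly_smul, ← sq, ← sq, smul_pow, map_smul, smul_eq_mul] at h
    exact h
  have hSsum : ∑ i ∈ S, normalized w i * grad₁ X E i = c * E (momentPoly X a 4) := by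
    rw [map_momentPoly_four, Finset.mul_sum, ← Finset.sum_subset (Finset.subset_univ S)]
    · exact Finset.sum_congr rfl fun i hi => by rw [hqa i hi]; ring
    · intro i _ hi
      have h1 : a i = w i * p i := rfl
      rw [h1, hpn i hi, mul_zero, zero_mul, mul_zero]
  have hexp : expect (normalized w) (grad₁ X E) = E (momentPoly X (normalized w) 4) := by
    rw [map_momentPoly_four, expect]
  rw [hexp, hSsum]
  refine le_trans ?_ hge
  refine le_trans ?_ (mul_le_mul_of_nonneg_left hq2 (sq_nonneg κ'))
  have hden : 0 < 1 - 2 * κ ^ 2 * ε := by linarith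
  rw [hκ', div_mul_eq_mul_div, le_div_iff₀ hden]
  set P := E (momentPoly X a 2 ^ 2)
  set T := E (momentPoly X a 4)
  have hTnn : 0 ≤ T := by
    show 0 ≤ E (momentPoly X a 4)
    rw [map_momentPoly_four]
    exact Finset.sum_nonneg fun i _ => mul_nonneg (ha0 i) (grad₁_nonneg hsq X i)
  have hnorm' : 1 - 2 * κ ^ 2 * ε ≤ c * (1 - κ ^ 2 * (r / S.card)) := by
    have : c * (1 - κ ^ 2 * (r / S.card)) = (S.card - κ ^ 2 * r) / N := by
      rw [hc, div_mul_eq_mul_div, mul_sub, mul_one, mul_left_comm, mul_div_cancel₀ _ hpos.ne']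
    rw [this, le_div_iff₀ hN]
    linarith
  calc 2 * (c * T) * (1 - 2 * κ ^ 2 * ε)
      ≤ 2 * (c * T) * (c * (1 - κ ^ 2 * (r / S.card))) := by gcongr
    _ = 2 * c ^ 2 * (T * (1 - κ ^ 2 * (r / S.card))) := by ring
    _ ≤ 2 * c ^ 2 * (κ ^ 2 * P) := by gcongr
    _ = 2 * κ ^ 2 * (c ^ 2 * P) := by ring

end HyperFilter

/-! ### Least squares -/

section LeastSquares

variable {n d : ℕ} {X : Covariates n d} {Y : Fin n → ℝ} {q : Fin n → ℝ}

theorem resid_add (X : Covariates n d) (Y : Fin n → ℝ) (θ v : EuclideanSpace ℝ (Fin d))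
    (i : Fin n) : resid X Y (θ + v) i = resid X Y θ i - inner ℝ v (X i) := by
  simp only [resid, inner_add_left]; ring

theorem expect_resid_add_sq (X : Covariates n d) (Y q : Fin n → ℝ)
    (θ v : EuclideanSpace ℝ (Fin d)) :
    expect q (fun i => resid X Y (θ + v) i ^ 2) = expect q (fun i => resid X Y θ i ^ 2)
      - 2 * (∑ i, q i * (resid X Y θ i * inner ℝ v (X i))) + secondMoment X q v := by
  simp only [expect, secondMoment, resid_add, Finset.mul_sum, ← Finset.sum_sub_distrib,
    ← Finset.sum_add_distrib]
  exact Finset.sum_congr rfl fun i _ => by ring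

theorem secondMoment_smul (X : Covariates n d) (q : Fin n → ℝ) (t : ℝ)
    (v : EuclideanSpace ℝ (Fin d)) : secondMoment X q (t • v) = t ^ 2 * secondMoment X q v := by
  simp only [secondMoment, expect, Finset.mul_sum]
  exact Finset.sum_congr rfl fun i _ => by rw [inner_smul_left]; simp; ring

/-- The normal equations. -/
theorem IsLeastSquares.sum_resid_mul_eq_zero {θ : EuclideanSpace ℝ (Fin d)}
    (h : IsLeastSquares X Y q θ) (v : EuclideanSpace ℝ (Fin d)) :
    ∑ i, q i * (resid X Y θ i * inner ℝ v (X i)) = 0 := by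
  set b := ∑ i, q i * (resid X Y θ i * inner ℝ v (X i)) with hb
  have key : ∀ t : ℝ, 0 ≤ secondMoment X q v * (t * t) + (-2 * b) * t + 0 := by
    intro t
    have h1 := h (θ + t • v)
    rw [expect_resid_add_sq, secondMoment_smul] at h1
    have h2 : ∑ i, q i * (resid X Y θ i * inner ℝ (t • v) (X i)) = t * b := by
      rw [hb, Finset.mul_sum]
      exact Finset.sum_congr rfl fun i _ => by rw [inner_smul_left]; simp; ring
    rw [h2] at h1
    linarith
  have := discrim_le_zero key
  unfold discrim at this
  nlinarith [sq_nonneg b]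

/-- The excess loss is the squared distance to the minimizer. -/
theorem IsLeastSquares.excess_eq {θ : EuclideanSpace ℝ (Fin d)} (h : IsLeastSquares X Y q θ)
    (θ' : EuclideanSpace ℝ (Fin d)) :
    expect q (fun i => resid X Y θ' i ^ 2) - expect q (fun i => resid X Y θ i ^ 2)
      = secondMoment X q (θ' - θ) := by
  have h1 := expect_resid_add_sq X Y q θ (θ' - θ)
  rw [add_sub_cancel, h.sum_resid_mul_eq_zero] at h1
  linarith

theorem inner_eq_zero_of_secondMoment_eq_zero (hq : ∀ i, 0 ≤ q i)
    {v : EuclideanSpace ℝ (Fin d)} (h : secondMoment X q v = 0) (i : Fin n) :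
    q i = 0 ∨ inner ℝ v (X i) = 0 := by
  unfold secondMoment expect at h
  have h1 := (Finset.sum_eq_zero_iff_of_nonneg
    (fun i _ => mul_nonneg (hq i) (sq_nonneg _))).1 h i (Finset.mem_univ _)
  rcases mul_eq_zero.1 h1 with h2 | h2
  · exact Or.inl h2
  · exact Or.inr (pow_eq_zero_iff two_ne_zero |>.1 h2)

/-- The noise moment is the same for every minimizer. -/
theorem noiseMoment_eq (hq : ∀ i, 0 ≤ q i) {θ : EuclideanSpace ℝ (Fin d)}
    (h : IsLeastSquares X Y q θ) (v : EuclideanSpace ℝ (Fin d)) :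
    noiseMoment X Y q v = ∑ i, q i * (resid X Y θ i ^ 2 * inner ℝ v (X i) ^ 2) := by
  have h0 := theta_isLeastSquares X Y q hq
  have h1 : secondMoment X q (theta X Y q - θ) = 0 := by
    refine le_antisymm ?_ (secondMoment_nonneg X hq _)
    rw [← h.excess_eq]
    linarith [h0 θ]
  unfold noiseMoment expect
  refine Finset.sum_congr rfl fun i _ => ?_
  rcases inner_eq_zero_of_secondMoment_eq_zero hq h1 i with h2 | h2
  · simp [h2]
  · have h3 : resid X Y (theta X Y q) i = resid X Y θ i := by
      have := resid_add X Y θ (theta X Y q - θ) i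
      rwa [add_sub_cancel, h2, sub_zero] at this
    simp only [h3]

theorem noiseMoment_le_of_quotient_le (hq : ∀ i, 0 ≤ q i) {c : ℝ}
    (h : ∀ w, 0 < secondMoment X q w → noiseMoment X Y q w / secondMoment X q w ≤ c)
    (v : EuclideanSpace ℝ (Fin d)) : noiseMoment X Y q v ≤ c * secondMoment X q v := by
  rcases (secondMoment_nonneg X hq v).eq_or_lt with h0 | h0
  · rw [← h0, mul_zero]
    unfold noiseMoment expect
    refine (Finset.sum_eq_zero fun i _ => ?_).le
    rcases inner_eq_zero_of_secondMoment_eq_zero hq h0.symm i with h2 | h2 <;> simp [h2]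
  · exact (div_le_iff₀ h0).1 (h v h0)

theorem noiseMoment_le_of_boundedNoise_le (hq : ∀ i, 0 ≤ q i) {c : ℝ}
    (h : boundedNoise X Y q ≤ (c : EReal)) (v : EuclideanSpace ℝ (Fin d)) :
    noiseMoment X Y q v ≤ c * secondMoment X q v := by
  refine noiseMoment_le_of_quotient_le hq (fun w hw => ?_) v
  have : ((noiseMoment X Y q w / secondMoment X q w : ℝ) : EReal) ≤ boundedNoise X Y q := by
    unfold boundedNoise
    exact le_iSup_of_le w (le_iSup_of_le hw le_rfl)
  exact EReal.coe_le_coe_iff.1 (this.trans h)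

end LeastSquares

/-! ### Distance between the regression parameters of overlapping distributions -/

section Distance

variable {n d : ℕ} {X : Covariates n d} {Y : Fin n → ℝ}

theorem sum_mul_sq_le {δ p h : Fin n → ℝ} {τ : ℝ} (hδ : ∀ i, 0 ≤ δ i) (hδp : ∀ i, δ i ≤ p i)
    (hτ : ∑ i, δ i ≤ τ) : (∑ i, δ i * h i) ^ 2 ≤ τ * ∑ i, p i * h i ^ 2 := by
  calc (∑ i, δ i * h i) ^ 2 ≤ (∑ i, δ i) * ∑ i, δ i * h i ^ 2 :=
        Finset.sum_sq_le_sum_mul_sum_of_sq_le_mul _ (fun i _ => hδ i)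
          (fun i _ => mul_nonneg (hδ i) (sq_nonneg _)) fun i _ => le_of_eq (by ring)
    _ ≤ τ * ∑ i, p i * h i ^ 2 := by
        have h1 : 0 ≤ ∑ i, δ i * h i ^ 2 :=
          Finset.sum_nonneg fun i _ => mul_nonneg (hδ i) (sq_nonneg _)
        have h2 : 0 ≤ τ := (Finset.sum_nonneg fun i _ => hδ i).trans hτ
        gcongr with i
        exact hδp i

/-- Removing mass `τ` from a hypercontractive distribution changes second moments by at most a
factor `1 - c √τ`. -/
theorem secondMoment_mul_le {p m : Fin n → ℝ} {τ c : ℝ} (hc : 0 ≤ c) (hm : ∀ i, 0 ≤ m i)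
    (hmp : ∀ i, m i ≤ p i) (hτ : ∑ i, (p i - m i) ≤ τ) {v : EuclideanSpace ℝ (Fin d)}
    (hyp : expect p (fun i => (inner ℝ v (X i)) ^ 4) ≤ c ^ 2 * secondMoment X p v ^ 2) :
    secondMoment X p v * (1 - c * √τ) ≤ secondMoment X m v := by
  have hδ : ∀ i, 0 ≤ p i - m i := fun i => sub_nonneg.2 (hmp i)
  have hτ0 : 0 ≤ τ := (Finset.sum_nonneg fun i _ => hδ i).trans hτ
  have h1 := sum_mul_sq_le (h := fun i => inner ℝ v (X i) ^ 2) hδ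
    (fun i => sub_le_self (p i) (hm i)) hτ
  have h2 : ∑ i, (p i - m i) * inner ℝ v (X i) ^ 2 = secondMoment X p v - secondMoment X m v := by
    simp only [secondMoment, expect, sub_mul, Finset.sum_sub_distrib]
  have h3 : ∑ i, p i * (inner ℝ v (X i) ^ 2) ^ 2 = expect p (fun i => (inner ℝ v (X i)) ^ 4) := by
    simp only [expect, ← pow_mul]
  rw [h2, h3] at h1
  have h4 : (secondMoment X p v - secondMoment X m v) ^ 2 ≤ (c * √τ * secondMoment X p v) ^ 2 := by
    refine h1.trans ?_
    rw [mul_pow, mul_pow, Real.sq_sqrt hτ0]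
    nlinarith [mul_le_mul_of_nonneg_left hyp hτ0]
  have hP := secondMoment_nonneg X (fun i => (hm i).trans (hmp i)) v
  have h5 := abs_le_of_sq_le_sq h4 (by positivity)
  linarith [le_abs_self (secondMoment X p v - secondMoment X m v)]

/-- A second-order bound under `p` controls a sum over a small part `δ` of `p`. -/
theorem sum_mul_le_sqrt {δ p f g : Fin n → ℝ} {τ c D : ℝ} (hδ : ∀ i, 0 ≤ δ i)
    (hδp : ∀ i, δ i ≤ p i) (hτ : ∑ i, δ i ≤ τ) (hc : 0 ≤ c) (hD : 0 ≤ D)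
    (h : ∑ i, p i * (f i ^ 2 * g i ^ 2) ≤ c ^ 2 * D) :
    |∑ i, δ i * (f i * g i)| ≤ √τ * (c * √D) := by
  have hτ0 : 0 ≤ τ := (Finset.sum_nonneg fun i _ => hδ i).trans hτ
  refine abs_le_of_sq_le_sq ?_ (by positivity)
  refine (sum_mul_sq_le hδ hδp hτ).trans ?_
  rw [mul_pow, mul_pow, Real.sq_sqrt hτ0, Real.sq_sqrt hD]
  simp only [mul_pow]
  gcongr

/-- The normal equations at `p` and at `q` compare the parameters on the common part of the two
distributions: on the rest, the noise bounds apply to each of them separately. -/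
theorem secondMoment_min_le {p q : Fin n → ℝ} {τ σ s : ℝ} {θp θq : EuclideanSpace ℝ (Fin d)}
    (hp : ∀ i, 0 ≤ p i) (hq : ∀ i, 0 ≤ q i)
    (hpτ : ∑ i, (p i - min (p i) (q i)) ≤ τ) (hqτ : ∑ i, (q i - min (p i) (q i)) ≤ τ)
    (hθp : IsLeastSquares X Y p θp) (hθq : IsLeastSquares X Y q θq) (hσ : 0 ≤ σ) (hs : 0 ≤ s)
    (hnp : ∀ v, noiseMoment X Y p v ≤ σ ^ 2 * secondMoment X p v)
    (hnq : ∀ v, noiseMoment X Y q v ≤ s ^ 2 * secondMoment X q v) :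
    secondMoment X (fun i => min (p i) (q i)) (θq - θp)
      ≤ √τ * (s * √(secondMoment X q (θq - θp)) + σ * √(secondMoment X p (θq - θp))) := by
  set Δ := θq - θp with hΔ
  have hr : ∀ i, resid X Y θq i = resid X Y θp i - inner ℝ Δ (X i) := fun i => by
    rw [← resid_add, hΔ, add_sub_cancel]
  have hmin : ∀ i, 0 ≤ min (p i) (q i) := fun i => le_min (hp i) (hq i)
  have h1 := sum_mul_le_sqrt (f := resid X Y θp) (g := fun i => inner ℝ Δ (X i))
    (fun i => sub_nonneg.2 (min_le_left (p i) (q i)))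
    (fun i => sub_le_self (p i) (hmin i)) hpτ hσ (secondMoment_nonneg X hp Δ)
    (by rw [← noiseMoment_eq hp hθp]; exact hnp Δ)
  have h2 := sum_mul_le_sqrt (f := resid X Y θq) (g := fun i => inner ℝ Δ (X i))
    (fun i => sub_nonneg.2 (min_le_right (p i) (q i)))
    (fun i => sub_le_self (q i) (hmin i)) hqτ hs (secondMoment_nonneg X hq Δ)
    (by rw [← noiseMoment_eq hq hθq]; exact hnq Δ)
  have e1 := hθp.sum_resid_mul_eq_zero Δ
  have e2 := hθq.sum_resid_mul_eq_zero Δ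
  have e3 : secondMoment X (fun i => min (p i) (q i)) Δ
      = ∑ i, (q i - min (p i) (q i)) * (resid X Y θq i * inner ℝ Δ (X i))
        - ∑ i, (p i - min (p i) (q i)) * (resid X Y θp i * inner ℝ Δ (X i))
        - ∑ i, q i * (resid X Y θq i * inner ℝ Δ (X i))
        + ∑ i, p i * (resid X Y θp i * inner ℝ Δ (X i)) := by
    simp only [secondMoment, expect, ← Finset.sum_sub_distrib, ← Finset.sum_add_distrib]
    refine Finset.sum_congr rfl fun i _ => ?_
    rw [hr]; ring
  rw [e3, e1, e2]
  have := neg_abs_le (∑ i, (p i - min (p i) (q i)) * (resid X Y θp i * inner ℝ Δ (X i)))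
  linarith [le_abs_self (∑ i, (q i - min (p i) (q i)) * (resid X Y θq i * inner ℝ Δ (X i)))]

theorem secondMoment_mono (X : Covariates n d) {p q : Fin n → ℝ} (h : ∀ i, p i ≤ q i)
    (v : EuclideanSpace ℝ (Fin d)) : secondMoment X p v ≤ secondMoment X q v := by
  unfold secondMoment expect
  exact Finset.sum_le_sum fun i _ => mul_le_mul_of_nonneg_right (h i) (sq_nonneg _)

/-- The distance between the regression parameters of two overlapping hypercontractive
distributions with bounded noise, measured under either of them. The bounds on `a √τ` and `b √τ`
make the second moments of `p`, of `q` and of their minimum comparable; `81/100` is `1 - 19/100`,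
and `11/10` is a bound for `√(7/6)`. -/
theorem secondMoment_sub_le {p q : Fin n → ℝ} {τ σ s a b : ℝ}
    {θp θq : EuclideanSpace ℝ (Fin d)}
    (hp : ∀ i, 0 ≤ p i) (hq : ∀ i, 0 ≤ q i) (hτ0 : 0 ≤ τ)
    (hpτ : ∑ i, (p i - min (p i) (q i)) ≤ τ) (hqτ : ∑ i, (q i - min (p i) (q i)) ≤ τ)
    (hθp : IsLeastSquares X Y p θp) (hθq : IsLeastSquares X Y q θq) (hσ : 0 ≤ σ) (hs : 0 ≤ s)
    (hnp : ∀ v, noiseMoment X Y p v ≤ σ ^ 2 * secondMoment X p v)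
    (hnq : ∀ v, noiseMoment X Y q v ≤ s ^ 2 * secondMoment X q v) (ha0 : 0 ≤ a) (hb0 : 0 ≤ b)
    (hyp : ∀ v, expect p (fun i => (inner ℝ v (X i)) ^ 4) ≤ a ^ 2 * secondMoment X p v ^ 2)
    (hyq : ∀ v, expect q (fun i => (inner ℝ v (X i)) ^ 4) ≤ b ^ 2 * secondMoment X q v ^ 2)
    (ha : a * √τ ≤ 1 / 7) (hb : b * √τ ≤ 19 / 100) :
    secondMoment X q (θq - θp) ≤ τ * ((s + 11 / 10 * σ) / (81 / 100)) ^ 2 ∧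
      secondMoment X p (θq - θp) ≤ 121 / 100 * secondMoment X q (θq - θp) := by
  set Δ := θq - θp with hΔ
  have hmin : ∀ i, 0 ≤ min (p i) (q i) := fun i => le_min (hp i) (hq i)
  have h1 := secondMoment_min_le hp hq hpτ hqτ hθp hθq hσ hs hnp hnq
  have h2 := secondMoment_mul_le ha0 hmin (fun i => min_le_left (p i) (q i)) hpτ (hyp Δ)
  have h3 := secondMoment_mul_le hb0 hmin (fun i => min_le_right (p i) (q i)) hqτ (hyq Δ)
  have h4 := secondMoment_mono X (fun i => min_le_right (p i) (q i)) Δ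
  have hP := secondMoment_nonneg X hp Δ
  have hQ := secondMoment_nonneg X hq Δ
  rw [← hΔ] at h1
  set P := secondMoment X p Δ
  set Q := secondMoment X q Δ
  set M := secondMoment X (fun i => min (p i) (q i)) Δ
  have hPQ : P ≤ 121 / 100 * Q := by
    have : P * (1 - 1 / 7) ≤ P * (1 - a * √τ) := by gcongr
    linarith
  refine ⟨?_, hPQ⟩
  have hxy : √P ≤ 11 / 10 * √Q := by
    rw [Real.sqrt_le_left (by positivity), mul_pow, Real.sq_sqrt hQ]
    linarith
  have h5 : Q * (81 / 100) ≤ √τ * ((s + 11 / 10 * σ) * √Q) := by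
    have e1 : Q * (1 - 19 / 100) ≤ Q * (1 - b * √τ) := by gcongr
    have e2 : √τ * (s * √Q + σ * √P) ≤ √τ * (s * √Q + σ * (11 / 10 * √Q)) := by gcongr
    linarith
  have h6 : √Q ≤ √τ * ((s + 11 / 10 * σ) / (81 / 100)) := by
    rcases (Real.sqrt_nonneg Q).eq_or_lt with h0 | h0
    · rw [← h0]; positivity
    · have : √Q * √Q = Q := Real.mul_self_sqrt hQ
      rw [← mul_div_assoc, le_div_iff₀ (by norm_num)]
      refine le_of_mul_le_mul_right ?_ h0
      calc √Q * (81 / 100) * √Q = √Q * √Q * (81 / 100) := by ring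
        _ ≤ _ := by rw [this]; linarith
  calc Q = √Q ^ 2 := (Real.sq_sqrt hQ).symm
    _ ≤ (√τ * ((s + 11 / 10 * σ) / (81 / 100))) ^ 2 := by gcongr
    _ = _ := by rw [mul_pow, Real.sq_sqrt hτ0]

end Distance

/-! ### The constants -/

/-- The conditions of the filter on the fraction `ε` of outliers and on the hypercontractivity
constants `κ`, `κ'`. The positive quantity in the last field is the denominator of `σ'²`. -/
structure FilterParams (ε κ κ' : ℝ) : Prop where
  eps_nonneg : 0 ≤ ε
  one_le : 1 ≤ κ
  cube_lt : κ ^ 3 * ε < 1 / 64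
  nonneg' : 0 ≤ κ'
  sq_eq : κ' ^ 2 = 2 * κ ^ 2 / (1 - 2 * κ ^ 2 * ε)
  denom_pos : 0 < (1 - 2 * ε) ^ 3 - 20 * κ' ^ 3 * ε * (1 - ε)

namespace FilterParams

variable {ε κ κ' : ℝ}

theorem sq_mul_lt (h : FilterParams ε κ κ') : κ ^ 2 * ε < 1 / 64 := by
  have h1 : κ ^ 2 * ε ≤ κ ^ 3 * ε :=
    mul_le_mul_of_nonneg_right (pow_le_pow_right₀ h.one_le (by norm_num)) h.eps_nonneg
  linarith [h.cube_lt]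

theorem eps_lt (h : FilterParams ε κ κ') : ε < 1 / 64 := by
  have h1 : 1 * ε ≤ κ ^ 2 * ε :=
    mul_le_mul_of_nonneg_right (one_le_pow₀ h.one_le) h.eps_nonneg
  linarith [h.sq_mul_lt]

theorem two_mul_sq_le (h : FilterParams ε κ κ') : 2 * κ ^ 2 ≤ κ' ^ 2 := by
  have h0 : 0 ≤ κ ^ 2 * ε := mul_nonneg (sq_nonneg _) h.eps_nonneg
  rw [h.sq_eq, le_div_iff₀ (by linarith [h.sq_mul_lt])]
  nlinarith [sq_nonneg κ]

theorem mul_le (h : FilterParams ε κ κ') : 7 / 5 * κ ≤ κ' := by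
  refine le_of_sq_le_sq ?_ h.nonneg'
  nlinarith [h.two_mul_sq_le, sq_nonneg κ]

theorem sq_mul_le_cube (h : FilterParams ε κ κ') :
    28 * (κ' ^ 2 * (ε * (1 - ε))) ≤ 20 * κ' ^ 3 * ε * (1 - ε) := by
  have h1 : 7 / 5 ≤ κ' := by linarith [h.mul_le, h.one_le]
  have h2 : 0 ≤ κ' ^ 2 * (ε * (1 - ε)) :=
    mul_nonneg (sq_nonneg _) (mul_nonneg h.eps_nonneg (by linarith [h.eps_lt]))
  nlinarith [mul_le_mul_of_nonneg_right h1 h2]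

theorem mul_sqrt_le (h : FilterParams ε κ κ') : κ * √(ε / (1 - ε)) ≤ 1 / 7 := by
  have h1 : 0 < 1 - ε := by linarith [h.eps_lt]
  have hτ : 0 ≤ ε / (1 - ε) := div_nonneg h.eps_nonneg h1.le
  refine le_of_sq_le_sq ?_ (by norm_num)
  rw [mul_pow, Real.sq_sqrt hτ, ← mul_div_assoc, div_le_iff₀ h1]
  linarith [h.sq_mul_lt, h.eps_lt]

theorem mul_sqrt_le' (h : FilterParams ε κ κ') : κ' * √(ε / (1 - ε)) ≤ 19 / 100 := by
  have h1 : 0 < 1 - ε := by linarith [h.eps_lt]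
  have hτ : 0 ≤ ε / (1 - ε) := div_nonneg h.eps_nonneg h1.le
  refine le_of_sq_le_sq ?_ (by norm_num)
  rw [mul_pow, Real.sq_sqrt hτ, ← mul_div_assoc, div_le_iff₀ h1]
  refine le_of_mul_le_mul_right ?_ h1
  have h2 : (1 - 2 * ε) ^ 3 ≤ (1 - ε) ^ 2 := by
    nlinarith [h.eps_nonneg, h.eps_lt, mul_nonneg h.eps_nonneg h.eps_nonneg,
      mul_nonneg (mul_nonneg h.eps_nonneg h.eps_nonneg) h.eps_nonneg]
  nlinarith [h.sq_mul_le_cube, h.denom_pos]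

/-- `(1 - κ √τ)(1 + 2κ'√(ε(1-ε))) ≥ 1` for `τ = ε/(1-ε)`. -/
theorem one_le_mul (h : FilterParams ε κ κ') :
    1 ≤ (1 - κ * √(ε / (1 - ε))) * (1 + 2 * κ' * √(ε * (1 - ε))) := by
  have h1 : 0 < 1 - ε := by linarith [h.eps_lt]
  have hτ : 0 ≤ ε / (1 - ε) := div_nonneg h.eps_nonneg h1.le
  have h2 : √(ε * (1 - ε)) = (1 - ε) * √(ε / (1 - ε)) := by
    rw [← Real.sqrt_sq h1.le, ← Real.sqrt_mul (sq_nonneg _), Real.sqrt_sq h1.le]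
    congr 1; field_simp
  have h3 := h.mul_sqrt_le
  set A := κ * √(ε / (1 - ε)) with hA
  have hA0 : 0 ≤ A := mul_nonneg (by linarith [h.one_le]) (Real.sqrt_nonneg _)
  have h4 : 2 * A ≤ 2 * κ' * √(ε * (1 - ε)) := by
    rw [h2]
    have e1 : κ ≤ κ' * (1 - ε) := by
      nlinarith [h.mul_le, h.eps_lt, h.one_le]
    have := mul_le_mul_of_nonneg_right e1 (Real.sqrt_nonneg (ε / (1 - ε)))
    linarith
  nlinarith

/-- The inequality that the denominator of `σ'²` is made for: with `F` the noise under `q`, the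
first term bounds the part of `𝔼_q[g₂]` on `S` due to the noise of `p_S`, the second one the part
due to the distance between the two parameters, both relative to `F`. -/
theorem normalization_le (h : FilterParams ε κ κ') :
    (1 - ε) / (1 - 2 * ε) * ((1 - 2 * ε) ^ 3 - 20 * κ' ^ 3 * ε * (1 - ε))
      + 16 * (κ' ^ 2 * (ε / (1 - ε))) ≤ 1 := by
  have h1 : 0 < 1 - ε := by linarith [h.eps_lt]
  have h2 : 0 < 1 - 2 * ε := by linarith [h.eps_lt]
  have hε := h.eps_nonneg
  have hε' := h.eps_lt
  set t := κ' ^ 2 * (ε / (1 - ε)) with ht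
  have ht0 : 0 ≤ t := mul_nonneg (sq_nonneg _) (div_nonneg hε h1.le)
  have e1 : κ' ^ 2 * (ε * (1 - ε)) = t * (1 - ε) ^ 2 := by rw [ht]; field_simp
  have h3 := h.sq_mul_le_cube
  rw [e1] at h3
  have hc : 1 ≤ (1 - ε) / (1 - 2 * ε) := by rw [one_le_div h2]; linarith
  have h4 : (1 - ε) / (1 - 2 * ε) * (1 - 2 * ε) ^ 3 ≤ 1 := by
    have : (1 - ε) / (1 - 2 * ε) * (1 - 2 * ε) ^ 3 = (1 - ε) * (1 - 2 * ε) ^ 2 := by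
      field_simp
    rw [this]
    nlinarith [mul_nonneg hε hε, mul_nonneg (mul_nonneg hε hε) hε]
  have h5 : 16 * t ≤ 28 * (t * (1 - ε) ^ 2) := by
    have : 16 / 28 ≤ (1 - ε) ^ 2 := by nlinarith
    nlinarith
  have h6 : 20 * κ' ^ 3 * ε * (1 - ε)
      ≤ (1 - ε) / (1 - 2 * ε) * (20 * κ' ^ 3 * ε * (1 - ε)) :=
    le_mul_of_one_le_left (by linarith) hc
  rw [mul_sub]
  linarith

end FilterParams

/-! ### The noise filter removes mostly outliers -/

section NoiseFilter

variable {n d : ℕ} {X : Covariates n d} {Y : Fin n → ℝ} {S : Finset (Fin n)} {w : Fin n → ℝ}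
  {ε κ κ' σ σ' : ℝ}

theorem normalized_le_mul_empirical (hw : IsFilterWeight S w) (hS : (S.card : ℝ) = (1 - ε) * n)
    (hpos : 0 < (S.card : ℝ)) (hε : ε < 1 / 2) {i : Fin n} (hi : i ∈ S) :
    normalized w i ≤ (1 - ε) / (1 - 2 * ε) * empirical S i := by
  have hn : (0 : ℝ) < n := by
    rcases (n.cast_nonneg : (0 : ℝ) ≤ n).eq_or_lt with h | h
    · rw [hS, ← h, mul_zero] at hpos; exact absurd hpos (lt_irrefl _)
    · exact h
  have h2 : 0 < 1 - 2 * ε := by linarith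
  have hN : 0 < (1 - 2 * ε) * n := mul_pos h2 hn
  have h1 : 0 < 1 - ε := pos_of_mul_pos_left (hS ▸ hpos) hn.le
  have e : (1 - ε) / (1 - 2 * ε) * empirical S i = 1 / ((1 - 2 * ε) * n) := by
    rw [empirical, if_pos hi, hS]
    field_simp
  rw [e, normalized]
  exact div_le_div₀ zero_le_one (hw.le_one i) hN (hw.le_sum hS)

theorem sum_sq_mul_sq_le {q : Fin n → ℝ} (hq : ∀ i, 0 ≤ q i) {c : ℝ}
    (hyp : ∀ v, expect q (fun i => (inner ℝ v (X i)) ^ 4) ≤ c ^ 2 * secondMoment X q v ^ 2)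
    (u v : EuclideanSpace ℝ (Fin d)) :
    ∑ i, q i * (inner ℝ u (X i) ^ 2 * inner ℝ v (X i) ^ 2)
      ≤ c ^ 2 * (secondMoment X q u * secondMoment X q v) := by
  have hu := secondMoment_nonneg X hq u
  have hv := secondMoment_nonneg X hq v
  refine le_of_sq_le_sq ?_ (by positivity)
  have h1 : (∑ i, q i * (inner ℝ u (X i) ^ 2 * inner ℝ v (X i) ^ 2)) ^ 2
      ≤ expect q (fun i => (inner ℝ u (X i)) ^ 4) * expect q (fun i => (inner ℝ v (X i)) ^ 4) :=
    Finset.sum_sq_le_sum_mul_sum_of_sq_le_mul _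
      (fun i _ => mul_nonneg (hq i) (by positivity))
      (fun i _ => mul_nonneg (hq i) (by positivity)) fun i _ => le_of_eq (by ring)
  refine h1.trans ((mul_le_mul (hyp u) (hyp v) ?_ (by positivity)).trans (le_of_eq (by ring)))
  exact Finset.sum_nonneg fun i _ => mul_nonneg (hq i) (by positivity)

/-- The good points carry at most half of `𝔼_q[g₂]`. -/
theorem two_mul_sum_grad₂_le (hpar : FilterParams ε κ κ') (hw : IsFilterWeight S w)
    (hS : (S.card : ℝ) = (1 - ε) * n) (hpos : 0 < (S.card : ℝ)) (hN : 0 < ∑ i, w i)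
    (hσ : 0 < σ)
    (hσ' : σ' ^ 2 = 4 * σ ^ 2 * (1 + 2 * κ' * √(ε * (1 - ε))) /
      ((1 - 2 * ε) ^ 3 - 20 * κ' ^ 3 * ε * (1 - ε)))
    (hyp : certHyper X (empirical S) ≤ ((κ ^ 2 : ℝ) : EReal))
    (hnoise : boundedNoise X Y (empirical S) ≤ ((σ ^ 2 : ℝ) : EReal))
    (hyq : certHyper X (normalized w) ≤ ((κ' ^ 2 : ℝ) : EReal))
    {v : EuclideanSpace ℝ (Fin d)} (hv : Admissible₂ X Y σ' (normalized w) v) :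
    2 * ∑ i ∈ S, normalized w i * grad₂ X Y (normalized w) v i
      ≤ expect (normalized w) (grad₂ X Y (normalized w) v) := by
  obtain ⟨hDpos, hge, hmax⟩ := hv
  set p := empirical S with hp
  set q := normalized w with hq
  have hp0 : ∀ i, 0 ≤ p i := empirical_nonneg S
  have hq0 : ∀ i, 0 ≤ q i := normalized_nonneg hw.nonneg
  have h1 : 0 < 1 - ε := by linarith [hpar.eps_lt]
  have h2 : 0 < 1 - 2 * ε := by linarith [hpar.eps_lt]
  set τ := ε / (1 - ε) with hτ
  have hτ0 : 0 ≤ τ := div_nonneg hpar.eps_nonneg h1.le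
  have hqτ := hw.sum_sub_min_le hS hpos hN hpar.eps_nonneg
  have hpτ := hqτ
  rw [← sum_sub_min_comm ((sum_empirical hpos).trans (sum_normalized hN).symm)] at hpτ
  have hypp := expect_pow_four_le_of_certHyper_le X hp0 hyp
  have hypq := expect_pow_four_le_of_certHyper_le X hq0 hyq
  set F := noiseMoment X Y q v / secondMoment X q v with hF
  have hNF : noiseMoment X Y q v = F * secondMoment X q v := (div_mul_cancel₀ _ hDpos.ne').symm
  have hFσ : σ' ^ 2 ≤ F := (le_div_iff₀ hDpos).2 hge
  set D₀ := (1 - 2 * ε) ^ 3 - 20 * κ' ^ 3 * ε * (1 - ε) with hD₀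
  have hD₀pos : 0 < D₀ := hpar.denom_pos
  set h := 2 * κ' * √(ε * (1 - ε)) with hh
  have hh0 : 0 ≤ h := mul_nonneg (mul_nonneg zero_le_two hpar.nonneg') (Real.sqrt_nonneg _)
  have hF4 : 4 * σ ^ 2 * (1 + h) ≤ F * D₀ := by
    rw [hσ', div_le_iff₀ hD₀pos] at hFσ; exact hFσ
  have hF0 : 0 ≤ F := (sq_nonneg σ').trans hFσ
  have hσF : σ ≤ √F / 2 := by
    have hD1 : D₀ ≤ 1 := by
      have e1 : (1 - 2 * ε) ^ 3 ≤ 1 := pow_le_one₀ h2.le (by linarith [hpar.eps_nonneg])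
      have e2 : 0 ≤ 20 * κ' ^ 3 * ε * (1 - ε) := by
        have := hpar.nonneg'; have := hpar.eps_nonneg; positivity
      linarith
    refine le_of_sq_le_sq ?_ (by positivity)
    rw [div_pow, Real.sq_sqrt hF0]
    nlinarith [sq_nonneg σ]
  -- By the choice of `v`, the noise under `q` is at most `10/9 F` in every direction, and
  -- `1055/1000` exceeds `√(10/9)`.
  have hnq : ∀ u, noiseMoment X Y q u ≤ (1055 / 1000 * √F) ^ 2 * secondMoment X q u := by
    refine noiseMoment_le_of_quotient_le hq0 fun u hu => ?_
    rw [mul_pow, Real.sq_sqrt hF0]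
    linarith [hmax u hu]
  obtain ⟨hQ, -⟩ := secondMoment_sub_le hp0 hq0 hτ0 hpτ hqτ
    (theta_isLeastSquares X Y p hp0) (theta_isLeastSquares X Y q hq0) hσ.le (by positivity)
    (noiseMoment_le_of_boundedNoise_le hp0 hnoise) hnq (by linarith [hpar.one_le]) hpar.nonneg'
    hypp hypq hpar.mul_sqrt_le hpar.mul_sqrt_le'
  set Δ := theta X Y q - theta X Y p with hΔ
  have hQ4 : secondMoment X q Δ ≤ 4 * (τ * F) := by
    refine hQ.trans ?_
    have e1 : (1055 / 1000 * √F + 11 / 10 * σ) / (81 / 100) ≤ 2 * √F := by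
      rw [div_le_iff₀ (by norm_num)]
      linarith [Real.sqrt_nonneg F]
    calc τ * ((1055 / 1000 * √F + 11 / 10 * σ) / (81 / 100)) ^ 2 ≤ τ * (2 * √F) ^ 2 := by gcongr
      _ = 4 * (τ * F) := by rw [mul_pow, Real.sq_sqrt hF0]; ring
  -- The second moments of `p_S` and `q` in direction `v` are comparable.
  have hPv : secondMoment X p v ≤ (1 + h) * secondMoment X q v := by
    have e1 := secondMoment_mul_le (by linarith [hpar.one_le]) (fun i => le_min (hp0 i) (hq0 i))
      (fun i => min_le_left (p i) (q i)) hpτ (hypp v)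
    have e2 := secondMoment_mono X (fun i => min_le_right (p i) (q i)) v
    have e3 := mul_le_mul_of_nonneg_left hpar.one_le_mul (secondMoment_nonneg X hp0 v)
    rw [← hτ, ← hh] at e3
    have e4 := mul_le_mul_of_nonneg_right (e1.trans e2) (by linarith : 0 ≤ 1 + h)
    linarith
  set c := (1 - ε) / (1 - 2 * ε) with hc
  have hc0 : 0 ≤ c := div_nonneg h1.le h2.le
  have hsplit : ∑ i ∈ S, q i * grad₂ X Y q v i
      ≤ 2 * c * noiseMoment X Y p v
        + 2 * ∑ i, q i * (inner ℝ Δ (X i) ^ 2 * inner ℝ v (X i) ^ 2) := by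
    have e1 : ∀ i ∈ S, q i * grad₂ X Y q v i
        ≤ 2 * c * (p i * (resid X Y (theta X Y p) i ^ 2 * inner ℝ v (X i) ^ 2))
          + 2 * (q i * (inner ℝ Δ (X i) ^ 2 * inner ℝ v (X i) ^ 2)) := by
      intro i hi
      have hr : resid X Y (theta X Y q) i = resid X Y (theta X Y p) i - inner ℝ Δ (X i) := by
        rw [← resid_add, hΔ, add_sub_cancel]
      have hqi : q i ≤ c * p i :=
        normalized_le_mul_empirical hw hS hpos (by linarith [hpar.eps_lt]) hi
      set x := resid X Y (theta X Y p) i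
      set y := inner ℝ Δ (X i)
      set z := inner ℝ v (X i)
      have f1 : grad₂ X Y q v i = (x - y) ^ 2 * z ^ 2 := by rw [grad₂, hr]
      have f2 : (x - y) ^ 2 * z ^ 2 ≤ 2 * (x ^ 2 * z ^ 2) + 2 * (y ^ 2 * z ^ 2) := by
        nlinarith [mul_nonneg (sq_nonneg (x + y)) (sq_nonneg z)]
      have f3 := mul_le_mul_of_nonneg_left f2 (hq0 i)
      have f4 := mul_le_mul_of_nonneg_right hqi (by positivity : 0 ≤ x ^ 2 * z ^ 2)
      rw [f1]
      linarith
    refine (Finset.sum_le_sum e1).trans ?_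
    rw [noiseMoment, expect, Finset.mul_sum, Finset.mul_sum, ← Finset.sum_add_distrib]
    refine Finset.sum_le_sum_of_subset_of_nonneg (Finset.subset_univ S) fun i _ _ => ?_
    have := hp0 i
    have := hq0 i
    positivity
  have hexp : expect q (grad₂ X Y q v) = F * secondMoment X q v := hNF
  rw [hexp]
  have hnp := noiseMoment_le_of_boundedNoise_le hp0 hnoise v
  have hcross := sum_sq_mul_sq_le hq0 hypq Δ v
  set V := secondMoment X q v with hV
  have g1 : c * noiseMoment X Y p v * 4 ≤ c * D₀ * (F * V) := by
    calc c * noiseMoment X Y p v * 4 ≤ c * (σ ^ 2 * ((1 + h) * V)) * 4 := by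
          have := hnp.trans (mul_le_mul_of_nonneg_left hPv (sq_nonneg σ))
          gcongr
      _ = c * V * (4 * σ ^ 2 * (1 + h)) := by ring
      _ ≤ c * V * (F * D₀) := by gcongr
      _ = c * D₀ * (F * V) := by ring
  have g2 : ∑ i, q i * (inner ℝ Δ (X i) ^ 2 * inner ℝ v (X i) ^ 2)
      ≤ 4 * (κ' ^ 2 * τ) * (F * V) := by
    refine hcross.trans ?_
    calc κ' ^ 2 * (secondMoment X q Δ * V) ≤ κ' ^ 2 * (4 * (τ * F) * V) := by gcongr
      _ = 4 * (κ' ^ 2 * τ) * (F * V) := by ring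
  have g3 := mul_le_mul_of_nonneg_right hpar.normalization_le (mul_nonneg hF0 hDpos.le)
  rw [← hτ, ← hc, ← hD₀] at g3
  linarith

/-- The excess loss of any regression parameter of a hypercontractive filtered distribution with
bounded noise. -/
theorem excess_le (hpar : FilterParams ε κ κ') (hw : IsFilterWeight S w)
    (hS : (S.card : ℝ) = (1 - ε) * n) (hpos : 0 < (S.card : ℝ)) (hN : 0 < ∑ i, w i)
    (hσ : 0 ≤ σ) (hσ' : 0 ≤ σ')
    (hyp : certHyper X (empirical S) ≤ ((κ ^ 2 : ℝ) : EReal))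
    (hnoise : boundedNoise X Y (empirical S) ≤ ((σ ^ 2 : ℝ) : EReal))
    (hyq : certHyper X (normalized w) ≤ ((κ' ^ 2 : ℝ) : EReal))
    (hnq : boundedNoise X Y (normalized w) ≤ ((σ' ^ 2 : ℝ) : EReal))
    {θ : EuclideanSpace ℝ (Fin d)} (hθ : IsLeastSquares X Y (normalized w) θ) :
    expect (empirical S) (fun i => resid X Y θ i ^ 2)
      - expect (empirical S) (fun i => resid X Y (theta X Y (empirical S)) i ^ 2)
      ≤ 3 * ((κ + κ') * (σ + σ') ^ 2 * ε) := by
  have hp0 : ∀ i, 0 ≤ empirical S i := empirical_nonneg S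
  have hq0 : ∀ i, 0 ≤ normalized w i := normalized_nonneg hw.nonneg
  have h1 : 0 < 1 - ε := by linarith [hpar.eps_lt]
  have hqτ := hw.sum_sub_min_le hS hpos hN hpar.eps_nonneg
  have hpτ := hqτ
  rw [← sum_sub_min_comm ((sum_empirical hpos).trans (sum_normalized hN).symm)] at hpτ
  have hθp := theta_isLeastSquares X Y (empirical S) hp0
  rw [hθp.excess_eq]
  obtain ⟨hQ, hP⟩ := secondMoment_sub_le hp0 hq0 (div_nonneg hpar.eps_nonneg h1.le) hpτ hqτ
    hθp hθ hσ hσ'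
    (noiseMoment_le_of_boundedNoise_le hp0 hnoise) (noiseMoment_le_of_boundedNoise_le hq0 hnq)
    (by linarith [hpar.one_le]) hpar.nonneg'
    (expect_pow_four_le_of_certHyper_le X hp0 hyp) (expect_pow_four_le_of_certHyper_le X hq0 hyq)
    hpar.mul_sqrt_le hpar.mul_sqrt_le'
  have hε := hpar.eps_nonneg
  have hτ : ε / (1 - ε) ≤ 64 / 63 * ε := by
    rw [div_le_iff₀ h1]; nlinarith [hpar.eps_lt]
  have e1 : (σ' + 11 / 10 * σ) / (81 / 100) ≤ 11 / 8 * (σ + σ') := by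
    rw [div_le_iff₀ (by norm_num)]; linarith
  have e2 : ε / (1 - ε) * ((σ' + 11 / 10 * σ) / (81 / 100)) ^ 2
      ≤ 64 / 63 * ε * (11 / 8 * (σ + σ')) ^ 2 := by gcongr
  have e3 : 1 * ((σ + σ') ^ 2 * ε) ≤ (κ + κ') * ((σ + σ') ^ 2 * ε) := by
    have : 1 ≤ κ + κ' := by linarith [hpar.one_le, hpar.nonneg']
    gcongr
  have e4 : 0 ≤ (σ + σ') ^ 2 * ε := by positivity
  nlinarith

end NoiseFilter

/-! ### Executions of the algorithm -/

section Run

variable {n d : ℕ} {X : Covariates n d} {Y : Fin n → ℝ} {S : Finset (Fin n)}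
  {ε κ κ' σ σ' : ℝ}

theorem sum_weights_pos {w : Fin n → ℝ} (hpar : FilterParams ε κ κ') (hn : 0 < n)
    (hS : (S.card : ℝ) = (1 - ε) * n) (hw : IsFilterWeight S w) : 0 < ∑ i, w i := by
  have h2 : 0 < 1 - 2 * ε := by linarith [hpar.eps_lt]
  have hn' : (0 : ℝ) < n := by exact_mod_cast hn
  exact (mul_pos h2 hn').trans_le (hw.le_sum hS)

/-- Every iterate comes from a filter weight with at least as many zeros as updates made. -/
theorem Reaches.exists_filterWeight (hpar : FilterParams ε κ κ') (hn : 0 < n)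
    (hS : (S.card : ℝ) = (1 - ε) * n) (hpos : 0 < (S.card : ℝ)) (hσ : 0 < σ)
    (hσ' : σ' ^ 2 = 4 * σ ^ 2 * (1 + 2 * κ' * √(ε * (1 - ε))) /
      ((1 - 2 * ε) ^ 3 - 20 * κ' ^ 3 * ε * (1 - ε)))
    (hyp : certHyper X (empirical S) ≤ ((κ ^ 2 : ℝ) : EReal))
    (hnoise : boundedNoise X Y (empirical S) ≤ ((σ ^ 2 : ℝ) : EReal))
    {k : ℕ} {q : Fin n → ℝ} (h : Reaches X Y κ' σ' k q) :
    ∃ w, IsFilterWeight S w ∧ q = normalized w ∧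
      k ≤ (Finset.univ.filter fun i => w i = 0).card := by
  induction h with
  | init =>
    refine ⟨fun _ => 1, ⟨fun _ => zero_le_one, fun _ => le_rfl, by simp⟩, ?_, Nat.zero_le _⟩
    funext i
    simp [unif, normalized]
  | step _ hs ih =>
    obtain ⟨w, hw, rfl, hk⟩ := ih
    have hN := sum_weights_pos hpar hn hS hw
    have hq0 : ∀ i, 0 ≤ normalized w i := normalized_nonneg hw.nonneg
    cases hs with
    | hyper E _ hE =>
      have hκ' : 0 < κ' ^ 2 := by nlinarith [hpar.two_mul_sq_le, hpar.one_le]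
      have hg : 0 < expect (normalized w) (grad₁ X E) := by
        rw [expect, ← map_momentPoly_four]
        exact (mul_pos hκ' hE.2.1).trans_le hE.2.2
      obtain ⟨w', hw', he, hcard⟩ := hw.update_normalized hN
        (grad₁_nonneg hE.1.map_sq_nonneg X) hg
        (two_mul_sum_grad₁_le X hw hS hpos hN hpar.one_le hpar.eps_nonneg
          (by linarith [hpar.sq_mul_lt]) hpar.sq_eq hyp hE)
      exact ⟨w', hw', he, by omega⟩
    | noise v h₁ _ hv =>
      have hσ'pos : 0 < σ' ^ 2 := by
        rw [hσ']
        have := hpar.nonneg'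
        exact div_pos (by positivity) hpar.denom_pos
      have hg : 0 < expect (normalized w) (grad₂ X Y (normalized w) v) :=
        (mul_pos hσ'pos hv.1).trans_le hv.2.1
      obtain ⟨w', hw', he, hcard⟩ := hw.update_normalized hN
        (fun i => mul_nonneg (sq_nonneg _) (sq_nonneg _)) hg
        (two_mul_sum_grad₂_le hpar hw hS hpos hN hσ hσ' hyp hnoise (not_le.1 h₁).le hv)
      exact ⟨w', hw', he, by omega⟩

end Run

end RobustLinReg

theorem mainTheorem7 :
    ∃ C : ℝ, 0 < C ∧
      ∀ (n d : ℕ) (X : Covariates n d) (Y : Fin n → ℝ) (S : Finset (Fin n))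
        (ε κ σ κ' σ' : ℝ),
        0 < n → (S.card : ℝ) = (1 - ε) * n →
        1 ≤ κ → 0 < σ → κ ^ 3 * ε < 1 / 64 →
        certHyper X (empirical S) ≤ ((κ ^ 2 : ℝ) : EReal) →
        boundedNoise X Y (empirical S) ≤ ((σ ^ 2 : ℝ) : EReal) →
        0 ≤ κ' → κ' ^ 2 = 2 * κ ^ 2 / (1 - 2 * κ ^ 2 * ε) →
        0 < (1 - 2 * ε) ^ 3 - 20 * κ' ^ 3 * ε * (1 - ε) →
        0 ≤ σ' → σ' ^ 2 = 4 * σ ^ 2 * (1 + 2 * κ' * √(ε * (1 - ε))) /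
          ((1 - 2 * ε) ^ 3 - 20 * κ' ^ 3 * ε * (1 - ε)) →
        (∀ (k : ℕ) (q : Fin n → ℝ), Reaches X Y κ' σ' k q →
          (k : ℝ) ≤ C * (ε * n) ∧
            (Returns X Y κ' σ' q ∨ ∃ q' : Fin n → ℝ, Step X Y κ' σ' q q')) ∧
        (∀ (k : ℕ) (q : Fin n → ℝ), Reaches X Y κ' σ' k q → Returns X Y κ' σ' q →
          q ∈ stdSimplex ℝ (Fin n) ∧
          certHyper X q ≤ ((κ' ^ 2 : ℝ) : EReal) ∧
          boundedNoise X Y q ≤ ((σ' ^ 2 : ℝ) : EReal) ∧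
          tv q (empirical S) ≤ ε / (1 - ε) ∧
          ∀ θ : EuclideanSpace ℝ (Fin d), IsLeastSquares X Y q θ →
            expect (empirical S) (fun i => resid X Y θ i ^ 2) -
              expect (empirical S)
                (fun i => resid X Y (theta X Y (empirical S)) i ^ 2) ≤
              C * ((κ + κ') * (σ + σ') ^ 2 * ε)) := by
  refine ⟨3, by norm_num, ?_⟩
  intro n d X Y S ε κ σ κ' σ' hn hS hκ hσ hκε hyp hnoise hκ'0 hκ' hden hσ'0 hσ'
  have hn' : (0 : ℝ) < n := by exact_mod_cast hn
  have hε0 : 0 ≤ ε := by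
    have : 0 ≤ ε * n := by rw [← card_compl_eq hS]; positivity
    exact nonneg_of_mul_nonneg_left this hn'
  have hpar : FilterParams ε κ κ' := ⟨hε0, hκ, hκε, hκ'0, hκ', hden⟩
  have hpos : 0 < (S.card : ℝ) := by
    rw [hS]; exact mul_pos (by linarith [hpar.eps_lt]) hn'
  refine ⟨fun k q hk => ?_, fun k q hk hret => ?_⟩
  · obtain ⟨w, hw, rfl, hcard⟩ :=
      hk.exists_filterWeight hpar hn hS hpos hσ hσ' hyp hnoise
    have hq0 : ∀ i, 0 ≤ normalized w i := normalized_nonneg hw.nonneg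
    constructor
    · have h1 : (k : ℝ) ≤ 2 * (Sᶜ.card : ℝ) := (Nat.cast_le.2 hcard).trans hw.card_zero_le
      rw [card_compl_eq hS] at h1
      linarith [mul_nonneg hε0 hn'.le]
    · by_cases h₁ : ((κ' ^ 2 : ℝ) : EReal) ≤ certHyper X (normalized w)
      · obtain ⟨E, hE⟩ := exists_admissible₁ X hq0 h₁
        exact Or.inr ⟨_, Step.hyper _ E h₁ hE⟩
      · by_cases h₂ : ((σ' ^ 2 : ℝ) : EReal) ≤ boundedNoise X Y (normalized w)
        · obtain ⟨v, hv⟩ := exists_admissible₂ X Y hq0 h₂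
          exact Or.inr ⟨_, Step.noise _ v h₁ h₂ hv⟩
        · exact Or.inl ⟨h₁, h₂⟩
  · obtain ⟨w, hw, rfl, -⟩ := hk.exists_filterWeight hpar hn hS hpos hσ hσ' hyp hnoise
    have hN := sum_weights_pos hpar hn hS hw
    have hyq := (not_le.1 hret.1).le
    have hnq := (not_le.1 hret.2).le
    exact ⟨⟨normalized_nonneg hw.nonneg, sum_normalized hN⟩, hyq, hnq,
      tv_le_of_sum_sub_min_le (hw.sum_sub_min_le hS hpos hN hε0),
      fun θ hθ => excess_le hpar hw hS hpos hN hσ.le hσ'0 hyp hnoise hyq hnq hθ⟩
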